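/- Let $\mathbb F$ be the field with two elements and let $K$ be the field of Hahn series $a=\sum_{q\in\mathbb R}a_qt^q$ with coefficients $a_q\in\mathbb F$ and well-ordered support $\operatorname{supp}(a)=\{q\in\mathbb R: a_q\neq 0\}\subseteq\mathbb R$. Let $A=\{a\in K:\operatorname{supp}(a)\subseteq[0,\infty)\}$ be the Hahn ring, let $I_{>0}=\{a\in K:\operatorname{supp}(a)\subseteq(0,\infty)\}$, let $\Theta=K/I_{>0}$, regarded as an $A$-module, and for an $A$-module $M$ let $DM=\operatorname{Hom}_A(M,\Theta)$. We say that $M$ is $\Theta$-reflexive if the evaluation map $\chi_M\colon M\to D^2M$, $\chi_M(m)(\alpha)=\alpha(m)$, is an isomorphism. An $A$-module $M$ is basic if it is nonzero and for all $x,y\in M$ we have $x\in Ay$ or $y\in Ax$; it is multibasic if it is the internal direct sum of a finite (possibly empty) family of basic submodules. The standard intervals are the subsets $\mathbb R$, $[0,\infty)$, $(0,\infty)$, $(-\infty,0)$, $(-\infty,0]$, $\{0\}$ of $\mathbb R$ and $[0,q]$, $[0,q)$, $(0,q]$, $(0,q)$ for real $q>0$. For a standard interval $X$ put $L(X)=\{y\in\mathbb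 R: y\ge x\text{ for some }x\in X\}$, $R(X)=\{y\in\mathbb R: y>x\text{ for all }x\in X\}$ and $$Q(X)=\{a\in K:\operatorname{supp}(a)\subseteq L(X)\}\,/\,\{a\in K:\operatorname{supp}(a)\subseteq R(X)\}.$$ The $A$-modules $Q(X)$ are called the standard basic modules. **Theorem.** An $A$-module $M$ is $\Theta$-reflexive if and only if it is multibasic. Moreover, let $M$ be a multibasic $A$-module. Then: 1. $M$ is the internal direct sum of a finite family of submodules, each isomorphic to a standard basic module. 2. If $M=\bigoplus_{i=1}^m N_i=\bigoplus_{j=1}^n N'_j$ with $N_i\cong Q(X_i)$ and $N'_j\cong Q(X'_j)$ for standard intervals $X_i,X'_j$, then there is a bijection $\sigma\colon\{1,\dots,m\}\to\{1,\dots,n\}$ with $X_i=X'_{\sigma(i)}$ for all $i$. 3. If $M=\bigoplus_{i=1}^m N_i=\bigoplus_{j=1}^n N'_j$ with all $N_i$ and $N'_j$ basic submodules, then there is a bijection $\sigma\colon\{1,\dots,m\}\to\{1,\dots,n\}$ with $N_i\cong N'_{\sigma(i)}$ for all $i$. -/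

import Mathlib

noncomputable section

namespace HahnTheory

/-- The field `K` of Hahn series with value group `ℝ` and coefficients in the field of order 2. -/
abbrev K : Type := HahnSeries ℝ (ZMod 2)

/-- The Hahn ring `A`: the Hahn series whose support is contained in `[0, ∞)`. -/
def A : Subring K where
  carrier := {a | a.support ⊆ Set.Ici 0}
  mul_mem' := by
    intro a b ha hb q hq
    obtain ⟨u, hu, v, hv, rfl⟩ := HahnSeries.support_mul_subset hq
    exact Set.mem_Ici.2 (add_nonneg (Set.mem_Ici.1 (ha hu)) (Set.mem_Ici.1 (hb hv)))
  one_mem' := by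
    intro q hq
    have h := HahnSeries.support_single_subset hq
    exact le_of_eq h.symm
  add_mem' := by
    intro a b ha hb q hq
    exact (HahnSeries.support_add_subset a b hq).elim (fun h => ha h) (fun h => hb h)
  zero_mem' := by simp
  neg_mem' := by
    intro a ha
    simpa using ha

/-- The `A`-submodule of `K` of all Hahn series whose support lies in a given upper set of `ℝ`. -/
def supportedIn (L : UpperSet ℝ) : Submodule A K where
  carrier := {a | a.support ⊆ L}
  add_mem' := by
    intro a b ha hb q hq
    exact (HahnSeries.support_add_subset a b hq).elim (fun h => ha h) (fun h => hb h)
  zero_mem' := by simp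
  smul_mem' := by
    intro c a ha q hq
    obtain ⟨u, hu, v, hv, rfl⟩ := HahnSeries.support_mul_subset (x := (c : K)) (y := a) hq
    exact L.upper (le_add_of_nonneg_left (c.2 hu)) (ha hv)

/-- `I_{>0}`: the Hahn series with support contained in `(0, ∞)`. -/
def IPos : Submodule A K := supportedIn ⟨Set.Ioi 0, isUpperSet_Ioi 0⟩

/-- `Θ = K / I_{>0}`. -/
abbrev Theta : Type := K ⧸ IPos

/-- `D M = Hom_A(M, Θ)`. -/
abbrev D (M : Type*) [AddCommGroup M] [Module A M] : Type _ := M →ₗ[A] Theta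

/-- The evaluation map `M → D (D M)`, sending `m` to `α ↦ α m`. -/
def evalMap (M : Type*) [AddCommGroup M] [Module A M] : M →ₗ[A] D (D M) where
  toFun m :=
    { toFun := fun α => α m
      map_add' := fun _ _ => rfl
      map_smul' := fun _ _ => rfl }
  map_add' := by intro x y; ext α; exact α.map_add x y
  map_smul' := by intro c x; ext α; exact α.map_smul c x

/-- `M` is `Θ`-reflexive if the evaluation map `M → D (D M)` is an isomorphism. -/
def IsThetaReflexive (M : Type*) [AddCommGroup M] [Module A M] : Prop :=
  Function.Bijective (evalMap M)

/-- `M` is basic if it is nonzero and `x ∈ A y` or `y ∈ A x` for all `x, y ∈ M`. -/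
def IsBasic (M : Type*) [AddCommGroup M] [Module A M] : Prop :=
  Nontrivial M ∧ ∀ x y : M, (∃ a : A, x = a • y) ∨ (∃ a : A, y = a • x)

/-- A finite (possibly empty) family of basic submodules of which `M` is the internal direct
sum. -/
def IsBasicDecomposition {M : Type*} [AddCommGroup M] [Module A M] {n : ℕ}
    (N : Fin n → Submodule A M) : Prop :=
  (∀ i, IsBasic (N i)) ∧ DirectSum.IsInternal N

/-- `M` is multibasic if it is the direct sum of finitely many basic submodules. -/
def IsMultibasic (M : Type*) [AddCommGroup M] [Module A M] : Prop :=
  ∃ (n : ℕ) (N : Fin n → Submodule A M), IsBasicDecomposition N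

/-- The standard intervals. -/
def IsStandardInterval (X : Set ℝ) : Prop :=
  X = Set.univ ∨ X = Set.Ici 0 ∨ X = Set.Ioi 0 ∨ X = Set.Iio 0 ∨ X = Set.Iic 0 ∨ X = {0} ∨
    ∃ q : ℝ, 0 < q ∧
      (X = Set.Icc 0 q ∨ X = Set.Ico 0 q ∨ X = Set.Ioc 0 q ∨ X = Set.Ioo 0 q)

/-- `L(X)`: the reals `y` with `y ≥ x` for some `x ∈ X`. -/
def leftHull (X : Set ℝ) : UpperSet ℝ where
  carrier := {y | ∃ x ∈ X, x ≤ y}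
  upper' := fun _ _ hyz ⟨x, hx, hxy⟩ => ⟨x, hx, hxy.trans hyz⟩

/-- `R(X)`: the reals `y` with `y > x` for all `x ∈ X`. -/
def rightPart (X : Set ℝ) : UpperSet ℝ where
  carrier := {y | ∀ x ∈ X, x < y}
  upper' := fun _ _ hyz hy x hx => (hy x hx).trans_le hyz

/-- `Q(X) = {a : supp a ⊆ L(X)} / {a : supp a ⊆ R(X)}`. For the standard intervals `X` these are
the standard basic modules. -/
abbrev Q (X : Set ℝ) : Type :=
  supportedIn (leftHull X) ⧸ (supportedIn (rightPart X)).submoduleOf (supportedIn (leftHull X))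

/-- A decomposition of `M` into standard basic modules: `M` is the internal direct sum of the
submodules `N i`, and `N i` is isomorphic to the standard basic module `Q (X i)`. -/
def IsStandardDecomposition {M : Type*} [AddCommGroup M] [Module A M] {n : ℕ}
    (N : Fin n → Submodule A M) (X : Fin n → Set ℝ) : Prop :=
  DirectSum.IsInternal N ∧
    ∀ i, IsStandardInterval (X i) ∧ Nonempty (N i ≃ₗ[A] Q (X i))

end HahnTheory

end

noncomputable section

namespace HahnTheory

/-! Everything rests on the linear compactness of `K`: compatible cosets have a common point, found
by gluing coefficients. Consequently every `A`-linear map from a submodule of `K` to a quotient `K ⧸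
I` is multiplication by an element of `K` (`exists_eq_mk_mul`). Hence each `K ⧸ I` is injective and
`Theta` separates points, so `evalMap` is always injective. A basic module is a subquotient `L / I`
of `K`, and an element of its double dual is multiplication by some `y`, which is forced to lie in
`L`. So basic modules, and finite direct sums of them, are reflexive.

Conversely, a reflexive module is linearly compact for decreasing sequences of submodules, so it
contains no infinite direct sum and embeds in a finite product of quotients of `K`. It is therefore
`P / S` with `S ≤ P ≤ Kⁿ`. The core of the proof is `exists_simultaneous_diagonalization`: one
`K`-basis makes both `P` and `S` products of submodules of `K`, which splits `P / S` into
subquotients of `K`.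

A submodule of `K` is determined by its upper set of exponents, so a basic module amounts to a
nonempty interval up to translation, and the standard intervals represent the translation classes.
Uniqueness is Krull–Schmidt, since basic modules have local endomorphism rings. -/

/-! ### Orders and the chain of submodules of `K` -/

theorem mem_A_of_order_nonneg {x : K} (h : 0 ≤ x.order) : x ∈ A := fun _ hq =>
  h.trans (HahnSeries.order_le_of_coeff_ne_zero hq)

theorem order_inv {x : K} (hx : x ≠ 0) : x⁻¹.order = -x.order := by
  have h := HahnSeries.order_mul hx (inv_ne_zero hx)
  rw [mul_inv_cancel₀ hx, HahnSeries.order_one] at h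
  linarith

theorem mem_IPos_iff {x : K} : x ∈ IPos ↔ x = 0 ∨ 0 < x.order := by
  constructor
  · intro h
    refine or_iff_not_imp_left.2 fun hx => ?_
    exact h (show x.coeff x.order ≠ 0 from mt HahnSeries.coeff_order_eq_zero.1 hx)
  · rintro (rfl | h)
    · exact IPos.zero_mem
    · exact fun q hq => h.trans_le (HahnSeries.order_le_of_coeff_ne_zero hq)

theorem one_notMem_IPos : (1 : K) ∉ IPos := by
  rw [mem_IPos_iff]
  simp

theorem inv_mem_A_of_notMem_IPos {x : K} (hx : x ∉ IPos) : x⁻¹ ∈ A := by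
  rw [mem_IPos_iff, not_or, not_lt] at hx
  exact mem_A_of_order_nonneg (by rw [order_inv hx.1]; linarith [hx.2])

theorem mul_mem_of_mem {N : Submodule A K} {u a : K} (hu : u ∈ A) (ha : a ∈ N) : u * a ∈ N :=
  N.smul_mem ⟨u, hu⟩ ha

theorem div_mem_A {a b : K} (ha : a ≠ 0) (h : a.order ≤ b.order) : b / a ∈ A := by
  rcases eq_or_ne b 0 with rfl | hb
  · simp [A.zero_mem]
  · refine mem_A_of_order_nonneg ?_
    rw [div_eq_mul_inv, HahnSeries.order_mul hb (inv_ne_zero ha), order_inv ha]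
    linarith

theorem mem_of_order_le {N : Submodule A K} {a b : K} (ha : a ∈ N) (ha0 : a ≠ 0)
    (h : a.order ≤ b.order) : b ∈ N := by
  rw [← div_mul_cancel₀ b ha0]
  exact mul_mem_of_mem (div_mem_A ha0 h) ha

theorem exists_smul_eq_or (a b : K) : (∃ u : A, a = u • b) ∨ ∃ u : A, b = u • a := by
  rcases eq_or_ne a 0 with rfl | ha
  · exact .inl ⟨0, by simp⟩
  rcases eq_or_ne b 0 with rfl | hb
  · exact .inr ⟨0, by simp⟩
  rcases le_total a.order b.order with h | h
  · exact .inr ⟨⟨_, div_mem_A ha h⟩, (div_mul_cancel₀ b ha).symm⟩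
  · exact .inl ⟨⟨_, div_mem_A hb h⟩, (div_mul_cancel₀ a hb).symm⟩

theorem submodule_le_total (N N' : Submodule A K) : N ≤ N' ∨ N' ≤ N := by
  by_contra! h
  obtain ⟨⟨a, ha, ha'⟩, ⟨b, hb, hb'⟩⟩ := h.imp SetLike.not_le_iff_exists.1 SetLike.not_le_iff_exists.1
  rcases exists_smul_eq_or a b with ⟨u, rfl⟩ | ⟨u, rfl⟩
  · exact ha' (N'.smul_mem u hb)
  · exact hb' (N.smul_mem u ha)

theorem single_ne_zero (q : ℝ) : (HahnSeries.single q 1 : K) ≠ 0 :=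
  HahnSeries.single_ne_zero one_ne_zero

theorem order_single (q : ℝ) : (HahnSeries.single q 1 : K).order = q :=
  HahnSeries.order_single one_ne_zero

theorem mem_iff_single_order_mem {N : Submodule A K} {a : K} (ha : a ≠ 0) :
    a ∈ N ↔ HahnSeries.single a.order 1 ∈ N :=
  ⟨fun h => mem_of_order_le h ha (order_single _).ge,
    fun h => mem_of_order_le h (single_ne_zero _) (order_single _).le⟩

theorem mem_iff_forall_support {N : Submodule A K} {a : K} :
    a ∈ N ↔ ∀ d ∈ a.support, HahnSeries.single d 1 ∈ N := by
  rcases eq_or_ne a 0 with rfl | ha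
  · simp
  constructor
  · intro h d hd
    refine mem_of_order_le h ha ?_
    rw [order_single]
    exact HahnSeries.order_le_of_coeff_ne_zero hd
  · intro h
    rw [mem_iff_single_order_mem ha]
    exact h _ (show a.coeff a.order ≠ 0 from mt HahnSeries.coeff_order_eq_zero.1 ha)

/-! ### Linear compactness of `K` and maps between its subquotients -/

/-- The field of Hahn series is linearly compact: a compatible family of cosets of the groups
of series supported in given upper sets has a common member. -/
theorem exists_forall_sub_support {ι : Type*} [LinearOrder ι] (x : ι → K) (V : ι → UpperSet ℝ)
    (h : ∀ i j, i ≤ j → (x j - x i).support ⊆ V i) :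
    ∃ y : K, ∀ i, (y - x i).support ⊆ V i := by
  classical
  have key : ∀ i j d, d ∉ V i → d ∉ V j → (x i).coeff d = (x j).coeff d := by
    have aux : ∀ i j d, i ≤ j → d ∉ V i → (x i).coeff d = (x j).coeff d := by
      intro i j d hij hd
      have h1 : d ∉ (x j - x i).support := fun h2 => hd (h i j hij h2)
      rw [HahnSeries.mem_support, not_not, HahnSeries.coeff_sub, sub_eq_zero] at h1
      exact h1.symm
    intro i j d hi hj
    rcases le_total i j with hij | hij
    · exact aux i j d hij hi
    · exact (aux j i d hij hj).symm
  -- Outside `V i` the coefficients of a solution must be those of `x i`; exponents lying in every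
  -- `V i` are unconstrained and get coefficient 0.
  let f : ℝ → ZMod 2 := fun d => if hd : ∃ i, d ∉ V i then (x hd.choose).coeff d else 0
  have hf : ∀ i d, d ∉ V i → f d = (x i).coeff d := by
    intro i d hd
    have hd' : ∃ i, d ∉ V i := ⟨i, hd⟩
    simp only [f, dif_pos hd']
    exact key _ _ _ hd'.choose_spec hd
  have hwf : (Function.support f).IsWF := by
    rw [Set.isWF_iff_no_descending_seq]
    intro g hg hmem
    have h0 : ∃ i, g 0 ∉ V i := by
      by_contra hcon
      exact hmem 0 (by simp only [f, dif_neg hcon])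
    obtain ⟨i, hi⟩ := h0
    have hsupp : ∀ n, g n ∈ (x i).support := by
      intro n
      -- A descending sequence that starts outside the upper set `V i` stays outside it, hence would
      -- lie in the well-ordered support of `x i`.
      have hn : g n ∉ V i := fun hn => hi ((V i).upper (hg.antitone (Nat.zero_le n)) hn)
      rw [HahnSeries.mem_support, ← hf i _ hn]
      exact hmem n
    exact (Set.isWF_iff_no_descending_seq.1 (x i).isWF_support) g hg hsupp
  refine ⟨⟨f, hwf.isPWO⟩, fun i d hd => ?_⟩
  by_contra hdi
  refine hd ?_
  rw [HahnSeries.coeff_sub, ← hf i d hdi]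
  exact sub_self _

/-- A submodule of `K × K`, regarded as a linear relation, contains the graph of a multiplication
map over its domain. -/
theorem exists_mul_mem_relation (G : Submodule A (K × K)) :
    ∃ x : K, ∀ a c, (a, c) ∈ G → (a, a * x) ∈ G := by
  let N : Submodule A K := G.comap (LinearMap.inr A K K)
  have hN : ∀ c, c ∈ N ↔ ((0 : K), c) ∈ G := fun c => Iff.rfl
  -- The order is reversed because a smaller exponent `q` determines the multiplier more precisely:
  -- `c q / t q` is known up to those `y` with `t q * y ∈ N`, and this set shrinks with `q`.
  let ι := {q : ℝᵒᵈ // ∃ c, ((HahnSeries.single (OrderDual.ofDual q) 1 : K), c) ∈ G}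
  choose c hc using fun q : ι => q.2
  let t : ι → K := fun q => HahnSeries.single (OrderDual.ofDual q.1) 1
  have ht : ∀ q, t q ≠ 0 := fun q => single_ne_zero _
  have hG : ∀ q, (t q, c q) ∈ G := hc
  let V : ι → UpperSet ℝ := fun q =>
    ⟨{d | t q * HahnSeries.single d 1 ∈ N}, fun d e hde hd => by
      have hd' : t q * HahnSeries.single d 1 ∈ N := hd
      refine mem_of_order_le (N := N) hd' (mul_ne_zero (ht q) (single_ne_zero _)) ?_
      rw [HahnSeries.order_mul (ht q) (single_ne_zero _),
        HahnSeries.order_mul (ht q) (single_ne_zero _), order_single d, order_single e]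
      linarith⟩
  have hV : ∀ q (y : K), y.support ⊆ V q ↔ t q * y ∈ N := by
    intro q y
    let N' : Submodule A K := N.comap (LinearMap.mulLeft A (t q))
    exact (mem_iff_forall_support (N := N') (a := y)).symm
  obtain ⟨x, hx⟩ := exists_forall_sub_support (fun q => c q / t q) V (by
    intro p q hpq
    rw [hV, hN]
    have hu : t p / t q ∈ A := by
      refine div_mem_A (ht q) ?_
      rw [order_single, order_single]
      exact hpq
    have h1 := G.sub_mem (G.smul_mem ⟨_, hu⟩ (hG q)) (hG p)
    have e : (⟨_, hu⟩ : A) • (t q, c q) - (t p, c p) = (0, t p * (c q / t q - c p / t p)) := by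
      have e1 : ((⟨_, hu⟩ : A) • (t q, c q) : K × K) = (t p / t q * t q, t p / t q * c q) := rfl
      rw [e1, Prod.mk_sub_mk, div_mul_cancel₀ _ (ht q), sub_self, mul_sub,
        mul_div_cancel₀ _ (ht p)]
      congr 2
      ring
    rwa [e] at h1)
  refine ⟨x, fun a b hab => ?_⟩
  rcases eq_or_ne a 0 with rfl | ha
  · rw [zero_mul]
    exact G.zero_mem
  -- Up to a unit of `A`, the element `a` is the monomial of the same order, which reduces the claim
  -- to monomials.
  have hu : HahnSeries.single a.order 1 / a ∈ A := div_mem_A ha (order_single _).ge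
  have hu' : a / HahnSeries.single a.order 1 ∈ A :=
    div_mem_A (single_ne_zero _) (order_single _).le
  have hmem := G.smul_mem ⟨_, hu⟩ hab
  have e1 : ((⟨_, hu⟩ : A) • (a, b) : K × K) =
    (HahnSeries.single a.order 1 / a * a, HahnSeries.single a.order 1 / a * b) := rfl
  rw [e1, div_mul_cancel₀ _ ha] at hmem
  let q : ι := ⟨OrderDual.toDual a.order, _, hmem⟩
  have h2 := (hN _).1 ((hV q _).1 (hx q))
  have h3 := G.add_mem (hG q) h2
  rw [Prod.mk_add_mk, add_zero, mul_sub, mul_div_cancel₀ _ (ht q), add_sub_cancel] at h3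
  have h4 := G.smul_mem ⟨_, hu'⟩ h3
  have e2 : ((⟨_, hu'⟩ : A) • (t q, t q * x) : K × K) =
    (a / t q * t q, a / t q * (t q * x)) := rfl
  rwa [e2, ← mul_assoc, div_mul_cancel₀ _ (ht q)] at h4

/-- Every linear map from a submodule of `K` to a quotient of `K` is a multiplication map. -/
theorem exists_eq_mk_mul {L I : Submodule A K} (f : L →ₗ[A] K ⧸ I) :
    ∃ x : K, ∀ a : L, f a = I.mkQ (a * x) := by
  let G : Submodule A (K × K) :=
    { carrier := {p | ∃ h : p.1 ∈ L, f ⟨p.1, h⟩ = I.mkQ p.2}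
      add_mem' := by
        rintro ⟨a, b⟩ ⟨a', b'⟩ ⟨h, e⟩ ⟨h', e'⟩
        refine ⟨L.add_mem h h', ?_⟩
        simp only [Prod.mk_add_mk, map_add]
        rw [← e, ← e', ← map_add]
        rfl
      zero_mem' := ⟨L.zero_mem, by
        simp only [Prod.snd_zero, map_zero]
        exact f.map_zero⟩
      smul_mem' := by
        rintro u ⟨a, b⟩ ⟨h, e⟩
        refine ⟨L.smul_mem u h, ?_⟩
        simp only [Prod.smul_mk, map_smul]
        rw [← e, ← map_smul]
        rfl }
  obtain ⟨x, hx⟩ := exists_mul_mem_relation G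
  refine ⟨x, fun a => ?_⟩
  obtain ⟨c, hc⟩ := I.mkQ_surjective (f a)
  exact (hx a c ⟨a.2, hc.symm⟩).2

/-- An ideal of `A` is a submodule of `K`, so a map from it to `K ⧸ I` is multiplication by some
`x`, and the same formula extends it to `A`. By Baer's criterion `K ⧸ I` is injective. -/
theorem baer_quotient (I : Submodule A K) : Module.Baer A (K ⧸ I) := by
  intro J g
  let i : A →ₗ[A] K := LinearMap.toSpanSingleton A K 1
  have hi : ∀ a, i a = a := fun a => mul_one _
  have hinj : Function.Injective i := fun a b h => Subtype.ext (by rwa [hi, hi] at h)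
  let e := Submodule.equivMapOfInjective i hinj J
  obtain ⟨x, hx⟩ := exists_eq_mk_mul (g ∘ₗ e.symm.toLinearMap)
  refine ⟨I.mkQ ∘ₗ LinearMap.toSpanSingleton A K x, fun a ha => ?_⟩
  have h := hx (e ⟨a, ha⟩)
  simp only [LinearMap.comp_apply, LinearEquiv.coe_coe, e.symm_apply_apply] at h
  rw [h]
  simp only [LinearMap.comp_apply, e, Submodule.coe_equivMapOfInjective_apply, hi]
  rfl

/-! ### Separation by functionals -/

section Extension

variable {M : Type*} [AddCommGroup M] [Module A M]

/-- If `I` contains the annihilator of `x`, there is a linear map to `K ⧸ I` sending `x` to the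
class of `1`. -/
theorem exists_map_eq_mk_one (I : Submodule A K) (x : M)
    (h : ∀ a : A, a • x = 0 → (a : K) ∈ I) : ∃ f : M →ₗ[A] K ⧸ I, f x = I.mkQ 1 := by
  let s := LinearMap.toSpanSingleton A M x
  let g : (A ⧸ LinearMap.ker s) →ₗ[A] K ⧸ I :=
    (LinearMap.ker s).liftQ (I.mkQ ∘ₗ LinearMap.toSpanSingleton A K 1) (by
      intro a ha
      rw [LinearMap.mem_ker, LinearMap.comp_apply, Submodule.mkQ_apply,
        Submodule.Quotient.mk_eq_zero]
      rw [LinearMap.toSpanSingleton_apply]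
      have := h a ha
      rwa [← mul_one (a : K)] at this)
  let j : (A ⧸ LinearMap.ker s) →ₗ[A] M := (LinearMap.ker s).liftQ s le_rfl
  obtain ⟨f, hf⟩ := (baer_quotient I).extension_property j
    (LinearMap.ker_eq_bot.1 (Submodule.ker_liftQ_eq_bot _ _ _ le_rfl)) g
  refine ⟨f, ?_⟩
  have := LinearMap.congr_fun hf (Submodule.Quotient.mk 1)
  simp only [LinearMap.comp_apply, j, g, Submodule.liftQ_apply, s,
    LinearMap.toSpanSingleton_apply_one] at this
  exact this

theorem isUnit_of_notMem_IPos {a : A} (h : (a : K) ∉ IPos) : IsUnit a := by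
  have h0 : (a : K) ≠ 0 := fun h0 => h (h0 ▸ IPos.zero_mem)
  exact IsUnit.of_mul_eq_one ⟨_, inv_mem_A_of_notMem_IPos h⟩ (Subtype.ext (mul_inv_cancel₀ h0))

/-- The annihilator of `x ≠ 0` contains no unit, hence lies in `IPos`, so some functional sends `x`
to the nonzero class of 1. -/
theorem exists_functional_ne_zero {x : M} (hx : x ≠ 0) : ∃ α : D M, α x ≠ 0 := by
  obtain ⟨f, hf⟩ := exists_map_eq_mk_one IPos x (fun a ha => by
    by_contra h
    exact hx ((isUnit_of_notMem_IPos h).smul_eq_zero.1 ha))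
  refine ⟨f, ?_⟩
  rw [hf, Submodule.mkQ_apply, Ne, Submodule.Quotient.mk_eq_zero]
  exact one_notMem_IPos

theorem exists_functional_of_notMem {N : Submodule A M} {x : M} (hx : x ∉ N) :
    ∃ α : D M, (∀ y ∈ N, α y = 0) ∧ α x ≠ 0 := by
  obtain ⟨α, hα⟩ := exists_functional_ne_zero (x := N.mkQ x) (by simpa using hx)
  exact ⟨α ∘ₗ N.mkQ, fun y hy => by
    rw [LinearMap.comp_apply, Submodule.mkQ_apply, (Submodule.Quotient.mk_eq_zero N).2 hy,
      map_zero], hα⟩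

theorem evalMap_injective : Function.Injective (evalMap M) := by
  rw [injective_iff_map_eq_zero]
  intro x hx
  by_contra h
  obtain ⟨α, hα⟩ := exists_functional_ne_zero h
  exact hα (LinearMap.congr_fun hx α)

end Extension

/-! ### Projections of a direct sum -/

section DirectSums

variable {R M ι : Type*} [Ring R] [AddCommGroup M] [Module R M] [Fintype ι] [DecidableEq ι]

theorem exists_projections {N : ι → Submodule R M} (h : DirectSum.IsInternal N) :
    ∃ π : ∀ i, M →ₗ[R] N i, (∀ m, ∑ i, (π i m : M) = m) ∧ (∀ i (x : N i), π i x = x) ∧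
      ∀ i j, i ≠ j → ∀ x : N j, π i x = 0 := by
  let e := LinearEquiv.ofBijective (DirectSum.coeLinearMap N) h
  have he : ∀ i (x : N i), e.symm x = DirectSum.lof R ι (fun i => N i) i x := by
    intro i x
    rw [e.symm_apply_eq]
    exact (DirectSum.coeLinearMap_lof N i x).symm
  refine ⟨fun i => DirectSum.component R ι (fun i => N i) i ∘ₗ e.symm.toLinearMap, ?_, ?_, ?_⟩
  · intro m
    obtain ⟨f, rfl⟩ := e.surjective m
    simp only [LinearMap.comp_apply, LinearEquiv.coe_coe, e.symm_apply_apply]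
    conv_rhs => rw [← DirectSum.sum_univ_of f, map_sum]
    exact Finset.sum_congr rfl fun i _ => (DirectSum.coeLinearMap_lof N i (f i)).symm
  · intro i x
    rw [LinearMap.comp_apply, LinearEquiv.coe_coe, he, DirectSum.component.lof_self]
  · intro i j hij x
    rw [LinearMap.comp_apply, LinearEquiv.coe_coe, he]
    exact (DirectSum.component.of ..).trans (dif_neg hij.symm)

end DirectSums

/-! ### Basic modules and the reflexivity of multibasic modules -/

section Basic

variable {M : Type*} [AddCommGroup M] [Module A M]

/-- Pulled back to `L`, a functional is multiplication by some `x`, so `ψ` becomes a linear relation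
in `x` and is itself multiplication by some `y`. Once `y ∈ L` is known, `ψ` is evaluation at `g y`.
-/
theorem evalMap_surjective_of_surjective {L : Submodule A K} (g : L →ₗ[A] M)
    (hg : Function.Surjective g) : Function.Surjective (evalMap M) := by
  intro ψ
  let G : Submodule A (K × K) :=
    { carrier := {p | ∃ α : D M, (∀ a, α (g a) = IPos.mkQ (a * p.1)) ∧ ψ α = IPos.mkQ p.2}
      add_mem' := by
        rintro ⟨a, b⟩ ⟨a', b'⟩ ⟨α, h, e⟩ ⟨α', h', e'⟩
        refine ⟨α + α', fun c => ?_, ?_⟩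
        · rw [LinearMap.add_apply, h, h', ← map_add, ← mul_add]
          rfl
        · rw [map_add, e, e', ← map_add]
          rfl
      zero_mem' := ⟨0, fun c => by simp, by simp⟩
      smul_mem' := by
        rintro u ⟨a, b⟩ ⟨α, h, e⟩
        refine ⟨u • α, fun c => ?_, ?_⟩
        · rw [LinearMap.smul_apply, h, ← map_smul, ← mul_smul_comm]
          rfl
        · rw [map_smul, e, ← map_smul]
          rfl }
  obtain ⟨y, hy⟩ := exists_mul_mem_relation G
  have key : ∀ (α : D M) (x : K), (∀ a, α (g a) = IPos.mkQ (a * x)) → ψ α = IPos.mkQ (x * y) := by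
    intro α x hα
    obtain ⟨c, hc⟩ := IPos.mkQ_surjective (ψ α)
    obtain ⟨β, hβ, e⟩ := hy x c ⟨α, hα, hc.symm⟩
    have : α = β := by
      ext m
      obtain ⟨a, rfl⟩ := hg m
      rw [hα, hβ]
    rw [this, e]
  have hyL : y ∈ L := by
    -- If `y ∉ L`, then `L * y⁻¹ ⊆ IPos`, so `y⁻¹` represents the zero functional; but `ψ` would
    -- send it to the class of `y⁻¹ * y = 1`.
    by_contra hyL
    have hy0 : y ≠ 0 := fun h => hyL (h ▸ L.zero_mem)
    have h := key 0 y⁻¹ (fun a => by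
      rw [LinearMap.zero_apply, eq_comm, Submodule.mkQ_apply, Submodule.Quotient.mk_eq_zero]
      by_contra h1
      have ha : (a : K) ≠ 0 := fun ha => h1 (by rw [ha, zero_mul]; exact IPos.zero_mem)
      have h2 := mul_mem_of_mem (inv_mem_A_of_notMem_IPos h1) a.2
      rw [mul_inv, inv_inv, mul_right_comm, inv_mul_cancel₀ ha, one_mul] at h2
      exact hyL h2)
    rw [map_zero, inv_mul_cancel₀ hy0, eq_comm, Submodule.mkQ_apply,
      Submodule.Quotient.mk_eq_zero] at h
    exact one_notMem_IPos h
  refine ⟨g ⟨y, hyL⟩, ?_⟩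
  ext α
  obtain ⟨x, hx⟩ := exists_eq_mk_mul (α ∘ₗ g)
  rw [key α x hx, mul_comm]
  exact hx ⟨y, hyL⟩

/-- A basic module is isomorphic to a nonzero subquotient of `K`. -/
theorem IsBasic.exists_equiv_quotient (h : IsBasic M) :
    ∃ L I : Submodule A K, I < L ∧ Nonempty (M ≃ₗ[A] L ⧸ I.submoduleOf L) := by
  obtain ⟨⟨x, hx⟩, hM⟩ := (⟨@exists_ne _ h.1 0, h.2⟩ : (∃ x : M, x ≠ 0) ∧ _)
  let i : A →ₗ[A] K := LinearMap.toSpanSingleton A K 1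
  have hi : ∀ a, i a = a := fun a => mul_one _
  let I := (LinearMap.ker (LinearMap.toSpanSingleton A M x)).map i
  have hI : ∀ a : A, (a : K) ∈ I ↔ a • x = 0 := by
    intro a
    constructor
    · rintro ⟨b, hb, e⟩
      rw [hi] at e
      rwa [← Subtype.ext e]
    · exact fun h => ⟨a, h, hi a⟩
  obtain ⟨f, hf⟩ := exists_map_eq_mk_one I x (fun a => (hI a).2)
  have hfa : ∀ a : A, f (a • x) = I.mkQ a := fun a => by
    rw [map_smul, hf, ← map_smul, ← hi a]
    rfl
  -- On `A x` this holds because `I` is the annihilator of `x`. If instead `x = a • y`, then `f y =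
  -- 0` would give `f x = 0`, although `1 ∉ I`.
  have hinj : Function.Injective f := by
    rw [injective_iff_map_eq_zero]
    intro y hy
    rcases hM y x with ⟨a, rfl⟩ | ⟨a, rfl⟩
    · rw [hfa, Submodule.mkQ_apply, Submodule.Quotient.mk_eq_zero] at hy
      exact (hI a).1 hy
    · rw [map_smul, hy, smul_zero] at hf
      rw [eq_comm, Submodule.mkQ_apply, Submodule.Quotient.mk_eq_zero] at hf
      have := (hI 1).1 hf
      rw [one_smul] at this
      exact absurd this hx
  let L := (LinearMap.range f).comap I.mkQ
  let g : L →ₗ[A] LinearMap.range f := I.mkQ.restrict (fun a ha => ha)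
  have hg : Function.Surjective g := by
    rintro ⟨y, hy⟩
    obtain ⟨a, rfl⟩ := I.mkQ_surjective y
    exact ⟨⟨a, hy⟩, rfl⟩
  have hker : LinearMap.ker g = I.submoduleOf L := by
    ext a
    rw [LinearMap.mem_ker, Submodule.submoduleOf, Submodule.mem_comap, Submodule.coe_subtype,
      ← Submodule.Quotient.mk_eq_zero I]
    exact Subtype.ext_iff
  refine ⟨L, I, lt_of_le_of_ne ?_ ?_, ⟨(LinearEquiv.ofInjective f hinj).trans
    ((Submodule.quotEquivOfEq _ _ hker).symm.trans
      (g.quotKerEquivOfSurjective hg)).symm⟩⟩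
  · intro a ha
    rw [Submodule.mem_comap, Submodule.mkQ_apply, (Submodule.Quotient.mk_eq_zero I).2 ha]
    exact zero_mem _
  · intro e
    have h1 : (1 : K) ∈ L := ⟨x, hf⟩
    rw [← e] at h1
    have := (hI 1).1 h1
    rw [one_smul] at this
    exact hx this

theorem isBasic_of_surjective [Nontrivial M] {L : Submodule A K} (g : L →ₗ[A] M)
    (hg : Function.Surjective g) : IsBasic M := by
  refine ⟨inferInstance, fun x y => ?_⟩
  obtain ⟨a, rfl⟩ := hg x
  obtain ⟨b, rfl⟩ := hg y
  refine (exists_smul_eq_or (a : K) b).imp ?_ ?_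
  all_goals
    rintro ⟨u, hu⟩
    refine ⟨u, ?_⟩
    rw [← map_smul]
    exact congrArg g (Subtype.ext hu)

theorem IsBasic.evalMap_surjective (h : IsBasic M) : Function.Surjective (evalMap M) := by
  obtain ⟨L, I, -, ⟨e⟩⟩ := h.exists_equiv_quotient
  exact evalMap_surjective_of_surjective (e.symm.toLinearMap ∘ₗ (I.submoduleOf L).mkQ)
    (e.symm.surjective.comp (Submodule.mkQ_surjective _))

/-- A functional is the sum of its restrictions to the summands, so an element of the double dual
splits into components, each of which is an evaluation. -/
theorem IsMultibasic.isThetaReflexive (h : IsMultibasic M) : IsThetaReflexive M := by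
  obtain ⟨n, N, hN, hint⟩ := h
  refine ⟨evalMap_injective, fun ψ => ?_⟩
  obtain ⟨π, h1, -, -⟩ := exists_projections hint
  choose m hm using fun i => (hN i).evalMap_surjective (ψ ∘ₗ (π i).lcomp A Theta)
  refine ⟨∑ i, (m i : M), ?_⟩
  ext α
  have hα : α = ∑ i, (α ∘ₗ (N i).subtype) ∘ₗ π i := by
    ext x
    conv_lhs => rw [← h1 x, map_sum]
    simp
  conv_rhs => rw [hα, map_sum]
  change α (∑ i, (m i : M)) = _
  rw [map_sum]
  exact Finset.sum_congr rfl fun i _ => LinearMap.congr_fun (hm i) (α ∘ₗ (N i).subtype)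

end Basic

/-! ### Linear compactness of reflexive modules -/

section LinearCompactness

variable {M : Type*} [AddCommGroup M] [Module A M]

/-- A reflexive module is linearly compact, for decreasing sequences of cosets. -/
theorem IsThetaReflexive.exists_forall_sub_mem (h : IsThetaReflexive M) {N : ℕ → Submodule A M}
    (hN : Antitone N) (x : ℕ → M) (hx : ∀ i j, i ≤ j → x j - x i ∈ N i) :
    ∃ y, ∀ i, y - x i ∈ N i := by
  have mono : ∀ {i j : ℕ} {α : D M}, i ≤ j → (∀ m ∈ N i, α m = 0) → ∀ m ∈ N j, α m = 0 :=
    fun hij hα m hm => hα m (hN hij hm)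
  -- On functionals killing some `N i`, the values `α (x i)` are eventually constant. This limit
  -- value is a functional on `Y`; it extends to `D M` by injectivity and is then evaluation at the
  -- desired `y`.
  let Y : Submodule A (D M) :=
    { carrier := {α | ∃ i, ∀ m ∈ N i, α m = 0}
      add_mem' := by
        rintro α β ⟨i, hi⟩ ⟨j, hj⟩
        refine ⟨max i j, fun m hm => ?_⟩
        rw [LinearMap.add_apply, mono (le_max_left i j) hi m hm, mono (le_max_right i j) hj m hm,
          add_zero]
      zero_mem' := ⟨0, fun m _ => rfl⟩
      smul_mem' := by
        rintro u α ⟨i, hi⟩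
        exact ⟨i, fun m hm => by rw [LinearMap.smul_apply, hi m hm, smul_zero]⟩ }
  choose k hk using fun α : Y => α.2
  have hval : ∀ (α : Y) (i : ℕ), (∀ m ∈ N i, α.1 m = 0) → α.1 (x (k α)) = α.1 (x i) := by
    have aux : ∀ (α : D M) (i j : ℕ), i ≤ j → (∀ m ∈ N i, α m = 0) → α (x j) = α (x i) := by
      intro α i j hij hi
      rw [← sub_eq_zero, ← map_sub]
      exact hi _ (hx i j hij)
    intro α i hi
    rcases le_total (k α) i with hle | hle
    · exact (aux α.1 _ _ hle (hk α)).symm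
    · exact aux α.1 _ _ hle hi
  let ψ₀ : Y →ₗ[A] Theta :=
    { toFun := fun α => α.1 (x (k α))
      map_add' := by
        intro α β
        have hα := mono (le_max_left (k α) (k β)) (hk α)
        have hβ := mono (le_max_right (k α) (k β)) (hk β)
        rw [hval α _ hα, hval β _ hβ, hval (α + β) (max (k α) (k β)) (fun m hm => by
          rw [Submodule.coe_add, LinearMap.add_apply, hα m hm, hβ m hm, add_zero])]
        rfl
      map_smul' := by
        intro u α
        rw [hval (u • α) (k α) (fun m hm => by
          rw [Submodule.coe_smul, LinearMap.smul_apply, hk α m hm, smul_zero])]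
        rfl }
  obtain ⟨ψ, hψ⟩ := (baer_quotient IPos).extension_property
    (M := Y) (N := D M) Y.subtype Y.injective_subtype ψ₀
  obtain ⟨y, hy⟩ := h.2 ψ
  refine ⟨y, fun i => ?_⟩
  by_contra hi
  obtain ⟨α, hα, hne⟩ := exists_functional_of_notMem hi
  let α' : Y := ⟨α, i, hα⟩
  have h1 : ψ α = α (x i) := (LinearMap.congr_fun hψ α').trans (hval α' i hα)
  rw [← hy] at h1
  refine hne ?_
  rw [map_sub, sub_eq_zero]
  exact h1

/-- A reflexive module contains no infinite direct sum. -/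
theorem IsThetaReflexive.false_of_independent (h : IsThetaReflexive M) (x : ℕ → M)
    (hx0 : ∀ n, x n ≠ 0)
    (hx : ∀ n (a : A), a • x n ∈ Submodule.span A (x '' Set.Ici (n + 1)) → a • x n = 0) : False := by
  let X : ℕ → Submodule A M := fun n => Submodule.span A (x '' Set.Ici n)
  have hX : Antitone X := fun i j hij =>
    Submodule.span_mono (Set.image_mono (Set.Ici_subset_Ici.2 hij))
  have hxX : ∀ n k, n ≤ k → x k ∈ X n := fun n k hnk => Submodule.subset_span ⟨k, hnk, rfl⟩
  -- A limit `z` of the partial sums plays the role of the infinite sum of the `x i`, yet `z = z - y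
  -- 0` lies in the span of finitely many of them.
  let y : ℕ → M := fun n => ∑ i ∈ Finset.range n, x i
  obtain ⟨z, hz⟩ := h.exists_forall_sub_mem hX y (by
    intro i j hij
    simp only [y]
    rw [← Finset.sum_Ico_eq_sub _ hij]
    exact Submodule.sum_mem _ fun k hk => hxX i k (Finset.mem_Ico.1 hk).1)
  have indep : ∀ n (c : ℕ → A), ∑ i ∈ Finset.range n, c i • x i ∈ X n →
      ∀ i < n, c i • x i = 0 := by
    intro n
    have aux : ∀ k, k ≤ n → ∀ c : ℕ → A, ∑ i ∈ Finset.Ico k n, c i • x i ∈ X n →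
        ∀ i, k ≤ i → i < n → c i • x i = 0 := by
      intro k hk
      induction hk using Nat.decreasingInduction with
      | self => intro c _ i h1 h2; omega
      | of_succ k hk ih =>
        intro c hc
        rw [Finset.sum_eq_sum_Ico_succ_bot hk] at hc
        have h0 : c k • x k = 0 := by
          refine hx k (c k) ?_
          have h1 : ∑ i ∈ Finset.Ico (k + 1) n, c i • x i ∈ X (k + 1) :=
            Submodule.sum_mem _ fun i hi =>
              (X (k + 1)).smul_mem _ (hxX _ _ (Finset.mem_Ico.1 hi).1)
          exact (Submodule.add_mem_iff_left _ h1).1 (hX hk hc)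
        rw [h0, zero_add] at hc
        intro i h1 h2
        rcases h1.eq_or_lt with rfl | h1
        · exact h0
        · exact ih c hc i h1 h2
    intro c hc i hi
    exact aux 0 (Nat.zero_le n) c (by rwa [Nat.Ico_zero_eq_range]) i (Nat.zero_le i) hi
  have hz0 : ∃ n, ∃ c : ℕ → A, z = ∑ i ∈ Finset.range n, c i • x i := by
    have hz' : z ∈ Submodule.span A (Set.range x) := by
      have := hz 0
      simp only [y, X, Finset.range_zero, Finset.sum_empty, sub_zero] at this
      exact Submodule.span_mono (Set.image_subset_range _ _) this
    rw [Finsupp.mem_span_range_iff_exists_finsupp] at hz'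
    obtain ⟨c, rfl⟩ := hz'
    obtain ⟨n, hn⟩ := c.support.exists_nat_subset_range
    exact ⟨n, c, Finsupp.sum_of_support_subset _ hn _ (by simp)⟩
  obtain ⟨n, c, hc⟩ := hz0
  have h1 := hz (n + 1)
  classical
  -- Since `z` involves only `x i` with `i < n`, the coefficient of `x n` in `z - y (n + 1)` is
  -- `-1`; independence then forces `x n = 0`.
  let c' : ℕ → A := fun i => if i < n then c i - 1 else -1
  have h2 : z - y (n + 1) = ∑ i ∈ Finset.range (n + 1), c' i • x i := by
    rw [hc]
    simp only [y]
    rw [Finset.sum_range_succ, Finset.sum_range_succ, ← sub_sub, ← Finset.sum_sub_distrib,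
      sub_eq_add_neg]
    congr 1
    · refine Finset.sum_congr rfl fun i hi => ?_
      simp only [c', if_pos (Finset.mem_range.1 hi), sub_smul, one_smul]
    · simp [c']
  rw [h2] at h1
  have h3 := indep (n + 1) c' h1 n (Nat.lt_succ_self n)
  simp only [c', lt_irrefl, if_false, neg_smul, one_smul, neg_eq_zero] at h3
  exact hx0 n h3

/-- A reflexive module embeds in a finite product of quotients of `K`. -/
theorem IsThetaReflexive.exists_embedding (h : IsThetaReflexive M) :
    ∃ (n : ℕ) (I : Fin n → Submodule A K) (f : ∀ i, M →ₗ[A] K ⧸ I i),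
      ∀ m, (∀ i, f i m = 0) → m = 0 := by
  by_contra hcon
  -- These are the finite intersections of kernels of maps to quotients of `K`. If none is zero,
  -- pick `x ≠ 0` in one and intersect it with the kernel of a map injective on `A x`. Iterating
  -- gives an independent sequence.
  let T := {N : Submodule A M // ∃ (n : ℕ) (p : Fin n → Σ I : Submodule A K, (M →ₗ[A] K ⧸ I)),
    N = ⨅ i, LinearMap.ker (p i).2}
  have step : ∀ N : T, ∃ x : M, x ≠ 0 ∧ x ∈ N.1 ∧ ∃ N' : T, N'.1 ≤ N.1 ∧
      ∀ a : A, a • x ∈ N'.1 → a • x = 0 := by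
    rintro ⟨N, n, p, hp⟩
    have hN : N ≠ ⊥ := by
      intro hN
      refine hcon ⟨n, fun i => (p i).1, fun i => (p i).2, fun m hm => ?_⟩
      have : m ∈ N := by
        rw [hp, Submodule.mem_iInf]
        exact hm
      rwa [hN] at this
    obtain ⟨x, hxN, hx0⟩ := Submodule.exists_mem_ne_zero_of_ne_bot hN
    let i : A →ₗ[A] K := LinearMap.toSpanSingleton A K 1
    have hi : ∀ a, i a = a := fun a => mul_one _
    let I := (LinearMap.ker (LinearMap.toSpanSingleton A M x)).map i
    obtain ⟨f, hf⟩ := exists_map_eq_mk_one I x (fun a ha => ⟨a, ha, hi a⟩)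
    refine ⟨x, hx0, hxN, ⟨N ⊓ LinearMap.ker f, n + 1, Fin.cons ⟨I, f⟩ p, ?_⟩, inf_le_left, ?_⟩
    · rw [hp]
      ext m
      simp only [Submodule.mem_inf, Submodule.mem_iInf, Fin.forall_fin_succ]
      exact and_comm
    · rintro a ⟨-, ha⟩
      have ha' : f (a • x) = 0 := ha
      rw [map_smul, hf, ← map_smul, Submodule.mkQ_apply, Submodule.Quotient.mk_eq_zero] at ha'
      obtain ⟨b, hb, e⟩ := ha'
      have e' : b = a := Subtype.ext ((hi b).symm.trans (e.trans (hi a)))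
      rw [← e']
      exact hb
  choose x hx0 hxN next hle hann using step
  let N : ℕ → T := fun k => Nat.rec ⟨⊤, 0, Fin.elim0, (iInf_of_empty _).symm⟩ (fun _ N => next N) k
  have hanti : Antitone fun k => (N k).1 := antitone_nat_of_succ_le fun k => hle (N k)
  refine h.false_of_independent (fun k => x (N k)) (fun k => hx0 _) fun k a ha => ?_
  refine hann (N k) a ?_
  refine (Submodule.span_le.2 ?_ : _ ≤ (N (k + 1)).1) ha
  rintro _ ⟨j, hj, rfl⟩
  exact hanti hj (hxN (N j))

end LinearCompactness

/-! ### Simultaneous diagonalization of two submodules of `Kⁿ` -/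

section Diagonalization

variable {n : ℕ}

/-- A submodule of `K × Kⁿ` whose projection to `Kⁿ` is a product of submodules of `K` is obtained
from a product of submodules by a shear. -/
theorem exists_shear (T : Submodule A (K × (Fin n → K))) (U : Fin n → Submodule A K)
    (hT : ∀ w, (∃ c, (c, w) ∈ T) ↔ ∀ i, w i ∈ U i) :
    ∃ x : Fin n → K, ∀ c w, (c, w) ∈ T ↔
      (∀ i, w i ∈ U i) ∧ (c - Fintype.linearCombination K x w, (0 : Fin n → K)) ∈ T := by
  -- `G i` relates `a` to those `c` for which `c`, paired with `a` times the `i`-th unit vector,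
  -- lies in `T`. Its multiplier is the `i`-th shear coefficient.
  let G : Fin n → Submodule A (K × K) := fun i =>
    T.comap ((LinearMap.snd A K K).prod (LinearMap.single A (fun _ => K) i ∘ₗ LinearMap.fst A K K))
  have hG : ∀ i a c, (a, c) ∈ G i ↔ (c, Pi.single i a) ∈ T := fun i a c => Iff.rfl
  choose x hx using fun i => exists_mul_mem_relation (G i)
  have hmem : ∀ w, (∀ i, w i ∈ U i) → (Fintype.linearCombination K x w, w) ∈ T := by
    intro w hw
    have h1 : ∀ i, (w i * x i, (Pi.single i (w i) : Fin n → K)) ∈ T := by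
      intro i
      obtain ⟨c, hc⟩ := (hT (Pi.single i (w i))).2 (fun j => by
        rcases eq_or_ne j i with rfl | hj
        · rw [Pi.single_eq_same]
          exact hw j
        · rw [Pi.single_eq_of_ne hj]
          exact (U j).zero_mem)
      exact hx i _ c hc
    have h2 := T.sum_mem fun i (_ : i ∈ Finset.univ) => h1 i
    have h3 : ∑ i, (w i * x i, (Pi.single i (w i) : Fin n → K)) =
        (Fintype.linearCombination K x w, w) := by
      refine Prod.ext ?_ ?_
      · simp [Prod.fst_sum, Fintype.linearCombination_apply]
      · rw [Prod.snd_sum]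
        exact Finset.univ_sum_single w
    rwa [h3] at h2
  refine ⟨x, fun c w => ⟨fun h => ?_, fun ⟨hw, h⟩ => ?_⟩⟩
  · have hw := (hT w).1 ⟨c, h⟩
    refine ⟨hw, ?_⟩
    have := T.sub_mem h (hmem w hw)
    rwa [Prod.mk_sub_mk, sub_self] at this
  · have := T.add_mem h (hmem w hw)
    rwa [Prod.mk_add_mk, sub_add_cancel, zero_add] at this

/-- The automorphism of `K × V` composed of the shear along `K` given by the functional `l` and
the shear along `V` given by the vector `h`. -/
def shearEquiv {V : Type*} [AddCommGroup V] [Module K V] (l : V →ₗ[K] K) (h : V) :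
    (K × V) ≃ₗ[K] K × V where
  toFun v := (v.1 - l v.2, v.2 - (v.1 - l v.2) • h)
  invFun v := (v.1 + l (v.2 + v.1 • h), v.2 + v.1 • h)
  map_add' v v' := by
    refine Prod.ext ?_ ?_
    · simp only [Prod.fst_add, Prod.snd_add, map_add, add_sub_add_comm]
    · simp only [Prod.fst_add, Prod.snd_add, map_add, add_sub_add_comm, add_smul]
  map_smul' c v := by
    refine Prod.ext ?_ ?_
    · simp only [Prod.smul_fst, Prod.smul_snd, map_smul, RingHom.id_apply, smul_sub]
    · simp only [Prod.smul_fst, Prod.smul_snd, map_smul, RingHom.id_apply, smul_sub, sub_smul,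
        smul_assoc]
  left_inv v := by ext <;> simp
  right_inv v := by ext <;> simp

/-- After the shear by `l`, the submodule `S` is a product while `P` is still twisted by `d`. Choose
`k` with `U k * d k` largest. It contains `L`, and `W k * d k` contains `R`. So subtracting from `w`
the multiple of the `k`-th unit vector that lowers the value of `d` by the first coordinate untwists
`P` without leaving the products of the `U i` or of the `W i`. -/
theorem exists_splitting_of_functionals {P S : Submodule A (K × (Fin n → K))}
    {U W : Fin n → Submodule A K} {L R : Submodule A K} (l : (Fin n → K) →ₗ[K] K) (d : Fin n → K)
    (hX : ∀ c w, (c, w) ∈ P ↔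
      (∀ i, w i ∈ U i) ∧ (c - l w) - Fintype.linearCombination K d w ∈ L)
    (hY : ∀ c w, (c, w) ∈ S ↔ (∀ i, w i ∈ W i) ∧ c - l w ∈ R)
    (hd' : ∀ i, d i = 0 ∨ ((∃ a ∈ U i, a * d i ∉ L) ∧ ∃ a ∈ W i, a * d i ∉ R)) :
    ∃ (Ψ : (K × (Fin n → K)) ≃ₗ[K] K × (Fin n → K)) (L R : Submodule A K)
      (P' S' : Submodule A (Fin n → K)),
      (∀ v, v ∈ P ↔ (Ψ v).1 ∈ L ∧ (Ψ v).2 ∈ P') ∧ ∀ v, v ∈ S ↔ (Ψ v).1 ∈ R ∧ (Ψ v).2 ∈ S' := by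
  classical
  have hpi : ∀ (U : Fin n → Submodule A K) w, w ∈ Submodule.pi Set.univ U ↔ ∀ i, w i ∈ U i :=
    fun U w => by simp
  by_cases hd0 : d = 0
  · refine ⟨shearEquiv l 0, L, R, Submodule.pi Set.univ U,
      Submodule.pi Set.univ W, ?_, ?_⟩
    · rintro ⟨c, w⟩
      have h0 : Fintype.linearCombination K d w = 0 := by simp [hd0, Fintype.linearCombination_apply]
      rw [hX, hpi, h0, sub_zero, and_comm]
      simp [shearEquiv]
    · rintro ⟨c, w⟩
      rw [hY, hpi, and_comm]
      simp [shearEquiv]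
  -- Submodules of `K` form a chain, so one of the finitely many `F i` contains all the others.
  · let F : Fin n → Submodule A K := fun i => (U i).map (LinearMap.mulRight A (d i))
    obtain ⟨k, hk0, hk⟩ : ∃ k, d k ≠ 0 ∧ ∀ i, F i ≤ F k := by
      obtain ⟨k, hk⟩ := Set.Finite.exists_maximalFor F {i | d i ≠ 0} (Set.toFinite _) (by
        by_contra hne
        rw [Set.not_nonempty_iff_eq_empty, Set.eq_empty_iff_forall_notMem] at hne
        exact hd0 (funext fun i => not_not.1 (hne i)))
      refine ⟨k, hk.1, fun i => ?_⟩
      by_cases hi : d i = 0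
      · rintro _ ⟨a, -, rfl⟩
        simp [hi]
      · exact (submodule_le_total (F i) (F k)).elim id (fun h => hk.2 hi h)
    obtain ⟨⟨a, ha, ha'⟩, ⟨b, hb, hb'⟩⟩ := (hd' k).resolve_left hk0
    have hLF : L ≤ F k := (submodule_le_total L (F k)).elim id
      (fun h => absurd (h ⟨a, ha, rfl⟩) ha')
    have hRF : R ≤ (W k).map (LinearMap.mulRight A (d k)) :=
      (submodule_le_total R _).elim id (fun h => absurd (h ⟨b, hb, rfl⟩) hb')
    have hsub : ∀ (U : Fin n → Submodule A K) (a : K) (w : Fin n → K), a ∈ U k →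
        ((∀ i, (w - Pi.single k a : Fin n → K) i ∈ U i) ↔ ∀ i, w i ∈ U i) := by
      intro U a w ha
      refine forall_congr' fun i => ?_
      rw [Pi.sub_apply]
      refine (U i).sub_mem_iff_left ?_
      rcases eq_or_ne i k with rfl | hi
      · rwa [Pi.single_eq_same]
      · rw [Pi.single_eq_of_ne hi]
        exact (U i).zero_mem
    have hsm : ∀ a : K, (a * d k) • (Pi.single k (d k)⁻¹ : Fin n → K) = Pi.single k a := by
      intro a
      rw [← Pi.single_smul, smul_eq_mul, mul_assoc, mul_inv_cancel₀ hk0, mul_one]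
    obtain ⟨P', hP'⟩ : ∃ P' : Submodule A (Fin n → K), ∀ w, w ∈ P' ↔
        (∀ i, w i ∈ U i) ∧ Fintype.linearCombination K d w ∈ L :=
      ⟨{carrier := {w | (∀ i, w i ∈ U i) ∧ Fintype.linearCombination K d w ∈ L}
        add_mem' := fun h h' => ⟨fun i => (U i).add_mem (h.1 i) (h'.1 i), by
          rw [map_add]
          exact L.add_mem h.2 h'.2⟩
        zero_mem' := ⟨fun i => (U i).zero_mem, by
          rw [map_zero]
          exact L.zero_mem⟩
        smul_mem' := fun c w h => ⟨fun i => (U i).smul_mem c (h.1 i), by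
          rw [LinearMap.map_smul_of_tower]
          exact L.smul_mem c h.2⟩}, fun _ => Iff.rfl⟩
    refine ⟨shearEquiv l (Pi.single k (d k)⁻¹), F k, R,
      P',
      Submodule.pi Set.univ W, ?_, ?_⟩
    · rintro ⟨c, w⟩
      rw [hX]
      obtain ⟨c', hc'⟩ : ∃ c', c' = c - l w := ⟨_, rfl⟩
      have e1 : shearEquiv l (Pi.single k (d k)⁻¹) (c, w) =
        (c', w - c' • Pi.single k (d k)⁻¹) := by rw [hc']; rfl
      rw [e1, ← hc', hP']
      dsimp only
      have key : c' ∈ F k → ((∀ i, w i ∈ U i) ∧ c' - Fintype.linearCombination K d w ∈ L ↔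
          (∀ i, (w - c' • Pi.single k (d k)⁻¹ : Fin n → K) i ∈ U i) ∧
          Fintype.linearCombination K d (w - c' • Pi.single k (d k)⁻¹) ∈ L) := by
        rintro ⟨a, ha, rfl⟩
        rw [LinearMap.mulRight_apply, hsm, hsub U a w ha, map_sub,
          Fintype.linearCombination_apply_single, smul_eq_mul, ← L.neg_mem_iff, neg_sub]
      refine ⟨fun h => ?_, fun h => (key h.1).2 h.2⟩
      have hc : c' ∈ F k := by
        rw [← sub_add_cancel c' (Fintype.linearCombination K d w)]
        refine (F k).add_mem (hLF h.2) ?_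
        rw [Fintype.linearCombination_apply]
        exact (F k).sum_mem fun i _ => hk i ⟨w i, h.1 i, rfl⟩
      exact ⟨hc, (key hc).1 h⟩
    · rintro ⟨c, w⟩
      rw [hY]
      obtain ⟨c', hc'⟩ : ∃ c', c' = c - l w := ⟨_, rfl⟩
      have e1 : shearEquiv l (Pi.single k (d k)⁻¹) (c, w) =
        (c', w - c' • Pi.single k (d k)⁻¹) := by rw [hc']; rfl
      rw [e1, ← hc', hpi, and_comm]
      refine and_congr_right fun hc => ?_
      obtain ⟨a, ha, rfl⟩ := hRF hc
      rw [LinearMap.mulRight_apply, hsm, hsub W a w ha]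

/-- The shear coefficients of `P` matter only modulo those `e` with `U i * e ⊆ L`, those of `S` only
modulo those `f` with `W i * f ⊆ R`. If their difference is negligible on either side, that side is
adjusted so that they agree. Otherwise the difference satisfies both non-containments needed in
`exists_splitting_of_functionals`. -/
theorem exists_splitting (P S : Submodule A (K × (Fin n → K))) (U W : Fin n → Submodule A K)
    (hP : ∀ w, (∃ c, (c, w) ∈ P) ↔ ∀ i, w i ∈ U i)
    (hS : ∀ w, (∃ c, (c, w) ∈ S) ↔ ∀ i, w i ∈ W i) :
    ∃ (Ψ : (K × (Fin n → K)) ≃ₗ[K] K × (Fin n → K)) (L R : Submodule A K)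
      (P' S' : Submodule A (Fin n → K)),
      (∀ v, v ∈ P ↔ (Ψ v).1 ∈ L ∧ (Ψ v).2 ∈ P') ∧ ∀ v, v ∈ S ↔ (Ψ v).1 ∈ R ∧ (Ψ v).2 ∈ S' := by
  classical
  let L : Submodule A K := P.comap (LinearMap.inl A K (Fin n → K))
  let R : Submodule A K := S.comap (LinearMap.inl A K (Fin n → K))
  obtain ⟨X₀, hX₀⟩ := exists_shear P U hP
  obtain ⟨Y₀, hY₀⟩ := exists_shear S W hS
  have change : ∀ (T : Submodule A (K × (Fin n → K))) (U : Fin n → Submodule A K) (x e : Fin n → K)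
      (he : ∀ i, ∀ a ∈ U i, (a * e i, (0 : Fin n → K)) ∈ T)
      (hx : ∀ c w, (c, w) ∈ T ↔
        (∀ i, w i ∈ U i) ∧ (c - Fintype.linearCombination K x w, (0 : Fin n → K)) ∈ T),
      ∀ c w, (c, w) ∈ T ↔
        (∀ i, w i ∈ U i) ∧ (c - Fintype.linearCombination K (x + e) w, (0 : Fin n → K)) ∈ T := by
    intro T U x e he hx c w
    rw [hx]
    refine and_congr_right fun hw => ?_
    have h1 : (Fintype.linearCombination K e w, (0 : Fin n → K)) ∈ T := by
      have := Submodule.sum_mem (T.comap (LinearMap.inl A K (Fin n → K)))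
        fun i (_ : i ∈ Finset.univ) => he i (w i) (hw i)
      exact this
    have h2 : (c - Fintype.linearCombination K x w, (0 : Fin n → K)) =
        (c - Fintype.linearCombination K (x + e) w, (0 : Fin n → K)) +
          (Fintype.linearCombination K e w, (0 : Fin n → K)) := by
      rw [Prod.mk_add_mk, add_zero]
      congr 1
      simp only [Fintype.linearCombination_apply, Pi.add_apply, smul_add, Finset.sum_add_distrib]
      abel
    rw [h2]
    exact T.add_mem_iff_left h1
  have hmod : ∀ i, ∃ e f : K, (∀ a ∈ U i, a * e ∈ L) ∧ (∀ a ∈ W i, a * f ∈ R) ∧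
      (X₀ i + e = Y₀ i + f ∨ ((∃ a ∈ U i, a * (X₀ i + e - (Y₀ i + f)) ∉ L) ∧
        ∃ a ∈ W i, a * (X₀ i + e - (Y₀ i + f)) ∉ R)) := by
    intro i
    by_cases h1 : ∀ a ∈ U i, a * (Y₀ i - X₀ i) ∈ L
    · exact ⟨Y₀ i - X₀ i, 0, h1, fun a _ => by simp, .inl (by ring)⟩
    by_cases h2 : ∀ a ∈ W i, a * (X₀ i - Y₀ i) ∈ R
    · exact ⟨0, X₀ i - Y₀ i, fun a _ => by simp, h2, .inl (by ring)⟩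
    push Not at h1 h2
    refine ⟨0, 0, fun a _ => by simp, fun a _ => by simp, .inr ⟨?_, ?_⟩⟩
    · obtain ⟨a, ha, h⟩ := h1
      refine ⟨a, ha, fun h' => h ?_⟩
      rw [← L.neg_mem_iff]
      convert h' using 1
      ring
    · simpa using h2
  choose e f he hf hef using hmod
  have hX := change P U X₀ e he hX₀
  have hY := change S W Y₀ f hf hY₀
  obtain ⟨X, hXdef⟩ : ∃ X, X = X₀ + e := ⟨_, rfl⟩
  obtain ⟨Y, hYdef⟩ : ∃ Y, Y = Y₀ + f := ⟨_, rfl⟩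
  rw [← hXdef] at hX
  rw [← hYdef] at hY
  obtain ⟨d, hd⟩ : ∃ d, d = X - Y := ⟨_, rfl⟩
  have hd' : ∀ i, d i = 0 ∨ ((∃ a ∈ U i, a * d i ∉ L) ∧ ∃ a ∈ W i, a * d i ∉ R) := by
    intro i
    rw [hd, hXdef, hYdef]
    refine (hef i).imp (fun h => ?_) id
    exact sub_eq_zero.2 h
  have hlin : ∀ c w, c - Fintype.linearCombination K X w =
      (c - Fintype.linearCombination K Y w) - Fintype.linearCombination K d w := by
    intro c w
    simp only [hd, Fintype.linearCombination_apply, Pi.sub_apply, smul_sub,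
      Finset.sum_sub_distrib]
    abel
  replace hX : ∀ c w, (c, w) ∈ P ↔ (∀ i, w i ∈ U i) ∧
      (c - Fintype.linearCombination K Y w) - Fintype.linearCombination K d w ∈ L := by
    intro c w
    rw [hX, hlin]
    exact Iff.rfl
  replace hY : ∀ c w, (c, w) ∈ S ↔ (∀ i, w i ∈ W i) ∧
      (c - Fintype.linearCombination K Y w) ∈ R := hY
  exact exists_splitting_of_functionals (L := L) (R := R) _ d hX hY hd'

/-- Two submodules of `Kⁿ` have a common diagonalizing basis. -/
theorem exists_simultaneous_diagonalization (n : ℕ) : ∀ P S : Submodule A (Fin n → K),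
    ∃ (Φ : (Fin n → K) ≃ₗ[K] (Fin n → K)) (U W : Fin n → Submodule A K),
      (∀ v, v ∈ P ↔ ∀ i, Φ v i ∈ U i) ∧ ∀ v, v ∈ S ↔ ∀ i, Φ v i ∈ W i := by
  induction n with
  | zero =>
    intro P S
    refine ⟨LinearEquiv.refl K _, Fin.elim0, Fin.elim0, fun v => ?_, fun v => ?_⟩
    all_goals
      rw [Subsingleton.elim v 0]
      exact iff_of_true (zero_mem _) fun i => i.elim0
  | succ n ih =>
    intro P S
    let e : (Fin (n + 1) → K) ≃ₗ[K] K × (Fin n → K) := (Fin.consLinearEquiv K fun _ => K).symm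
    let e' := e.symm.restrictScalars A
    -- The induction hypothesis serves twice: here it makes the projections to `Kⁿ` products, as
    -- `exists_splitting` requires, and later it diagonalizes the complements `P'` and `S'`.
    obtain ⟨Φ₀, U₀, W₀, hU₀, hW₀⟩ :=
      ih (P.comap e'.toLinearMap |>.map (LinearMap.snd A _ _))
        (S.comap e'.toLinearMap |>.map (LinearMap.snd A _ _))
    let e₀ := ((LinearEquiv.refl K K).prodCongr Φ₀)
    obtain ⟨Ψ, L, R, P', S', hP', hS'⟩ := exists_splitting
      (P.comap ((e₀.symm.trans e.symm).restrictScalars A).toLinearMap)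
      (S.comap ((e₀.symm.trans e.symm).restrictScalars A).toLinearMap) U₀ W₀
      (by
        intro w
        have := hU₀ (Φ₀.symm w)
        rw [Φ₀.apply_symm_apply] at this
        rw [← this]
        simp [e₀, e'])
      (by
        intro w
        have := hW₀ (Φ₀.symm w)
        rw [Φ₀.apply_symm_apply] at this
        rw [← this]
        simp [e₀, e'])
    obtain ⟨Φ₁, U₁, W₁, hU₁, hW₁⟩ := ih P' S'
    refine ⟨((e.trans e₀).trans Ψ).trans (((LinearEquiv.refl K K).prodCongr Φ₁).trans e.symm),
      Fin.cons L U₁, Fin.cons R W₁, fun v => ?_, fun v => ?_⟩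
    · have := hP' (e₀ (e v))
      rw [hU₁] at this
      simp only [Submodule.mem_comap, LinearEquiv.coe_coe, LinearEquiv.restrictScalars_apply,
        LinearEquiv.trans_apply, LinearEquiv.symm_apply_apply] at this
      rw [this, Fin.forall_fin_succ]
      rfl
    · have := hS' (e₀ (e v))
      rw [hW₁] at this
      simp only [Submodule.mem_comap, LinearEquiv.coe_coe, LinearEquiv.restrictScalars_apply,
        LinearEquiv.trans_apply, LinearEquiv.symm_apply_apply] at this
      rw [this, Fin.forall_fin_succ]
      rfl

end Diagonalization

/-! ### Reflexive modules are multibasic -/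

section

variable {R M ι : Type*} [Ring R] [AddCommGroup M] [Module R M] [DecidableEq ι]

theorem isInternal_of_exists_of_forall [Fintype ι] {N : ι → Submodule R M}
    (h1 : ∀ m, ∃ x : ∀ i, N i, ∑ i, (x i : M) = m)
    (h2 : ∀ x : ∀ i, N i, ∑ i, (x i : M) = 0 → ∀ i, x i = 0) : DirectSum.IsInternal N := by
  constructor
  · rw [injective_iff_map_eq_zero]
    intro f hf
    ext i
    rw [← DirectSum.sum_univ_of f, map_sum] at hf
    simp only [DirectSum.coeAddMonoidHom_of] at hf
    simp [h2 (fun i => f i) hf i]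
  · intro m
    obtain ⟨x, hx⟩ := h1 m
    refine ⟨∑ i, DirectSum.of (fun i => N i) i (x i), ?_⟩
    rw [map_sum]
    simpa using hx

theorem isInternal_comp_equiv {κ : Type*} [DecidableEq κ] {N : ι → Submodule R M}
    (h : DirectSum.IsInternal N) (e : κ ≃ ι) : DirectSum.IsInternal (N ∘ e) := by
  rw [DirectSum.isInternal_submodule_iff_iSupIndep_and_iSup_eq_top] at h ⊢
  exact ⟨h.1.comp e.injective, by rw [← h.2]; exact e.iSup_comp⟩

end

section

variable {M : Type*} [AddCommGroup M] [Module A M]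

theorem isMultibasic_of_isInternal {ι : Type*} [Fintype ι] [DecidableEq ι]
    {N : ι → Submodule A M} (h : DirectSum.IsInternal N)
    (hN : ∀ i, N i ≠ ⊥ → IsBasic (N i)) : IsMultibasic M := by
  classical
  have h' := DirectSum.isInternal_ne_bot_iff.2 h
  let e := (Fintype.equivFin {i // N i ≠ ⊥}).symm
  exact ⟨_, _, fun i => hN _ (e i).2, isInternal_comp_equiv h' e⟩

/-- Inside a finite product of quotients of `K`, the module is `P / S`, with `P` its preimage in
`Kⁿ` and `S` the kernel of the quotient map. Diagonalizing `P` and `S` together makes it the direct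
sum of the images of the `U i`; the zero ones are discarded. -/
theorem IsThetaReflexive.isMultibasic (h : IsThetaReflexive M) : IsMultibasic M := by
  obtain ⟨n, I, f, hf⟩ := h.exists_embedding
  let F : M →ₗ[A] ∀ i, K ⧸ I i := LinearMap.pi f
  have hF : Function.Injective F := by
    rw [injective_iff_map_eq_zero]
    exact fun m hm => hf m fun i => congrFun hm i
  let q : (Fin n → K) →ₗ[A] ∀ i, K ⧸ I i := LinearMap.pi fun i => (I i).mkQ ∘ₗ LinearMap.proj i
  have hq : Function.Surjective q := by
    intro y
    choose v hv using fun i => (I i).mkQ_surjective (y i)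
    exact ⟨v, funext hv⟩
  obtain ⟨Φ, U, W, hU, hW⟩ := exists_simultaneous_diagonalization n
    ((LinearMap.range F).comap q) (LinearMap.ker q)
  have hsingle : ∀ (U : Fin n → Submodule A K) (i : Fin n), ∀ a ∈ U i, ∀ j,
      Φ (Φ.symm (Pi.single i a)) j ∈ U j := by
    intro U i a ha j
    rw [Φ.apply_symm_apply]
    rcases eq_or_ne j i with rfl | hj
    · rwa [Pi.single_eq_same]
    · rw [Pi.single_eq_of_ne hj]
      exact (U j).zero_mem
  let s : ∀ i, K →ₗ[A] ∀ i, K ⧸ I i := fun i =>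
    q ∘ₗ (Φ.symm.restrictScalars A).toLinearMap ∘ₗ LinearMap.single A (fun _ => K) i
  have hsum : ∀ a : Fin n → K, ∑ i, s i (a i) = q (Φ.symm a) := by
    intro a
    conv_rhs => rw [← Finset.univ_sum_single a, map_sum, map_sum]
    rfl
  let ψ : ∀ i, U i →ₗ[A] M := fun i =>
    (LinearEquiv.ofInjective F hF).symm.toLinearMap ∘ₗ
      (s i ∘ₗ (U i).subtype).codRestrict (LinearMap.range F)
        (fun a => (hU _).2 (hsingle U i a a.2))
  have hψ : ∀ i a, F (ψ i a) = s i a := by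
    intro i a
    exact congrArg Subtype.val ((LinearEquiv.ofInjective F hF).apply_symm_apply _)
  refine isMultibasic_of_isInternal (N := fun i => LinearMap.range (ψ i))
    (isInternal_of_exists_of_forall ?_ ?_) ?_
  · intro m
    obtain ⟨v, hv⟩ := hq (F m)
    have hvU := (hU v).1 ⟨m, hv.symm⟩
    refine ⟨fun i => ⟨_, ⟨Φ v i, hvU i⟩, rfl⟩, hF ?_⟩
    rw [map_sum]
    simp only [hψ]
    rw [hsum, Φ.symm_apply_apply, hv]
  · intro x hx
    choose a ha using fun i => (x i).2
    have h0 := congrArg F hx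
    rw [map_sum, map_zero] at h0
    simp only [← ha, hψ] at h0
    rw [hsum (fun i => a i)] at h0
    have hWa := (hW _).1 (LinearMap.mem_ker.2 h0)
    rw [Φ.apply_symm_apply] at hWa
    intro i
    refine Subtype.ext (hF ?_)
    rw [← ha, hψ, ZeroMemClass.coe_zero, map_zero]
    exact LinearMap.mem_ker.1 ((hW _).2 (hsingle W i _ (hWa i)))
  · intro i hi
    have := Submodule.nontrivial_iff_ne_bot.2 hi
    exact isBasic_of_surjective (ψ i).rangeRestrict (ψ i).surjective_rangeRestrict

theorem isThetaReflexive_iff_isMultibasic : IsThetaReflexive M ↔ IsMultibasic M :=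
  ⟨IsThetaReflexive.isMultibasic, IsMultibasic.isThetaReflexive⟩

end

/-! ### Standard intervals and the classification of basic modules -/

theorem isStandardInterval_ordConnected {X : Set ℝ} (hX : IsStandardInterval X) :
    X.OrdConnected := by
  rcases hX with rfl | rfl | rfl | rfl | rfl | rfl | ⟨q, -, rfl | rfl | rfl | rfl⟩ <;>
    infer_instance

theorem isStandardInterval_nonempty {X : Set ℝ} (hX : IsStandardInterval X) : X.Nonempty := by
  rcases hX with rfl | rfl | rfl | rfl | rfl | rfl | ⟨q, hq, rfl | rfl | rfl | rfl⟩
  · exact Set.univ_nonempty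
  · exact Set.nonempty_Ici
  · exact Set.nonempty_Ioi
  · exact Set.nonempty_Iio
  · exact Set.nonempty_Iic
  · exact Set.singleton_nonempty 0
  · exact Set.nonempty_Icc.2 hq.le
  · exact Set.nonempty_Ico.2 hq
  · exact Set.nonempty_Ioc.2 hq
  · exact Set.nonempty_Ioo.2 hq

theorem isStandardInterval_trichotomy {X : Set ℝ} (hX : IsStandardInterval X) :
    X = Set.univ ∨ IsGLB X 0 ∨ (¬ BddBelow X ∧ IsLUB X 0) := by
  rcases hX with rfl | rfl | rfl | rfl | rfl | rfl | ⟨q, hq, rfl | rfl | rfl | rfl⟩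
  · exact .inl rfl
  · exact .inr (.inl isGLB_Ici)
  · exact .inr (.inl isGLB_Ioi)
  · exact .inr (.inr ⟨not_bddBelow_Iio 0, isLUB_Iio⟩)
  · exact .inr (.inr ⟨not_bddBelow_Iic 0, isLUB_Iic⟩)
  · exact .inr (.inl isGLB_singleton)
  · exact .inr (.inl (isGLB_Icc hq.le))
  · exact .inr (.inl (isGLB_Ico hq))
  · exact .inr (.inl (isGLB_Ioc hq))
  · exact .inr (.inl (isGLB_Ioo hq))

theorem exists_isStandardInterval_preimage {X : Set ℝ} (hX : X.OrdConnected) (hne : X.Nonempty) :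
    ∃ d : ℝ, IsStandardInterval ((fun x => x + d) ⁻¹' X) := by
  rcases (isPreconnected_iff_ordConnected.2 hX).mem_intervals with
    h | h | h | h | h | h | h | h | h | h
  all_goals
    rw [h] at hne ⊢
  · refine ⟨sInf X, ?_⟩
    rw [Set.preimage_add_const_Icc, sub_self]
    rcases (Set.nonempty_Icc.1 hne).eq_or_lt with h' | h'
    · rw [h', sub_self, Set.Icc_self]
      simp [IsStandardInterval]
    · have := sub_pos.2 h'
      exact .inr (.inr (.inr (.inr (.inr (.inr ⟨_, this, .inl rfl⟩)))))
  · refine ⟨sInf X, ?_⟩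
    rw [Set.preimage_add_const_Ico, sub_self]
    have := sub_pos.2 (Set.nonempty_Ico.1 hne)
    exact .inr (.inr (.inr (.inr (.inr (.inr ⟨_, this, .inr (.inl rfl)⟩)))))
  · refine ⟨sInf X, ?_⟩
    rw [Set.preimage_add_const_Ioc, sub_self]
    have := sub_pos.2 (Set.nonempty_Ioc.1 hne)
    exact .inr (.inr (.inr (.inr (.inr (.inr ⟨_, this, .inr (.inr (.inl rfl))⟩)))))
  · refine ⟨sInf X, ?_⟩
    rw [Set.preimage_add_const_Ioo, sub_self]
    have := sub_pos.2 (Set.nonempty_Ioo.1 hne)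
    exact .inr (.inr (.inr (.inr (.inr (.inr ⟨_, this, .inr (.inr (.inr rfl))⟩)))))
  · exact ⟨sInf X, .inr (.inl (by rw [Set.preimage_add_const_Ici, sub_self]))⟩
  · exact ⟨sInf X, .inr (.inr (.inl (by rw [Set.preimage_add_const_Ioi, sub_self])))⟩
  · exact ⟨sSup X, .inr (.inr (.inr (.inr (.inl (by rw [Set.preimage_add_const_Iic, sub_self])))))⟩
  · exact ⟨sSup X, .inr (.inr (.inr (.inl (by rw [Set.preimage_add_const_Iio, sub_self]))))⟩
  · exact ⟨0, .inl rfl⟩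
  · exact absurd hne Set.not_nonempty_empty

/-- Standard intervals which are translates of each other are equal. -/
theorem isStandardInterval_eq_of_translate {X X' : Set ℝ} (hX : IsStandardInterval X)
    (hX' : IsStandardInterval X') {d : ℝ} (h : ∀ s, s ∈ X ↔ s + d ∈ X') : X = X' := by
  have himg : X' = OrderIso.addRight d '' X := by
    ext s
    constructor
    · exact fun hs => ⟨s - d, (h _).2 (by rwa [sub_add_cancel]), sub_add_cancel s d⟩
    · rintro ⟨s, hs, rfl⟩
      exact (h s).1 hs
  -- Translation moves the infimum, or the supremum when there is no lower bound, by `d`; for a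
  -- standard interval other than `ℝ` this endpoint is 0.
  suffices d = 0 ∨ X = Set.univ by
    rcases this with rfl | h1
    · ext s
      rw [h, add_zero]
    · rw [himg, h1, Set.image_univ, (OrderIso.addRight d).range_eq]
  rcases isStandardInterval_trichotomy hX with h1 | h1 | ⟨h1, h2⟩
  · exact .inr h1
  · have h3 : IsGLB X' (OrderIso.addRight d 0) := by
      rw [himg]
      exact (OrderIso.addRight d).isGLB_image'.2 h1
    rcases isStandardInterval_trichotomy hX' with h4 | h4 | ⟨h4, -⟩
    · rw [h4] at h3
      exact absurd h3.bddBelow not_bddBelow_univ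
    · left
      simpa using h3.unique h4
    · exact absurd h3.bddBelow h4
  · have h3 : IsLUB X' (OrderIso.addRight d 0) := by
      rw [himg]
      exact (OrderIso.addRight d).isLUB_image'.2 h2
    rcases isStandardInterval_trichotomy hX' with h4 | h4 | ⟨-, h4⟩
    · rw [h4] at h3
      exact absurd h3.bddAbove not_bddAbove_univ
    · refine absurd ?_ h1
      have := h4.bddBelow
      rw [himg] at this
      exact (OrderIso.addRight d).bddBelow_image.1 this
    · left
      simpa using h3.unique h4

theorem single_mem_supportedIn {H : UpperSet ℝ} {s : ℝ} :
    HahnSeries.single s 1 ∈ supportedIn H ↔ s ∈ H := by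
  change HahnSeries.support (HahnSeries.single s 1) ⊆ (H : Set ℝ) ↔ _
  rw [HahnSeries.support_single_of_ne one_ne_zero, Set.singleton_subset_iff, SetLike.mem_coe]

theorem mem_leftHull_and_notMem_rightPart {X : Set ℝ} (hX : X.OrdConnected) {s : ℝ} :
    s ∈ X ↔ s ∈ leftHull X ∧ s ∉ rightPart X := by
  constructor
  · exact fun hs => ⟨⟨s, hs, le_rfl⟩, fun h => lt_irrefl s (h s hs)⟩
  · rintro ⟨⟨x, hx, hxs⟩, h⟩
    have h' : ¬ ∀ x ∈ X, x < s := h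
    push Not at h'
    obtain ⟨y, hy, hsy⟩ := h'
    exact hX.out hx hy ⟨hxs, hsy⟩

theorem nonempty_quotient_equiv {L I L' I' : Submodule A K} {c : K} (hc : c ≠ 0)
    (hL : ∀ a, a ∈ L' ↔ c * a ∈ L) (hI : ∀ a, a ∈ I' ↔ c * a ∈ I) :
    Nonempty ((L ⧸ I.submoduleOf L) ≃ₗ[A] L' ⧸ I'.submoduleOf L') := by
  let e : L' ≃ₗ[A] L := LinearEquiv.ofBijective
    ((LinearMap.mulLeft A c).restrict fun a ha => (hL a).1 ha) (by
      constructor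
      · intro a b hab
        exact Subtype.ext (mul_left_cancel₀ hc (congrArg Subtype.val hab))
      · intro b
        have hb : c * (c⁻¹ * b) = b := mul_inv_cancel_left₀ hc _
        exact ⟨⟨c⁻¹ * b, (hL _).2 (by rw [hb]; exact b.2)⟩, Subtype.ext hb⟩)
  refine ⟨(Submodule.Quotient.equiv _ _ e ?_).symm⟩
  ext b
  constructor
  · rintro ⟨a, ha, rfl⟩
    exact (hI _).1 ha
  · intro hb
    refine ⟨e.symm b, (hI _).2 ?_, e.apply_symm_apply b⟩
    have : c * (e.symm b : K) = b := congrArg Subtype.val (e.apply_symm_apply b)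
    change c * (e.symm b : K) ∈ I
    rw [this]
    exact hb

section

variable {M : Type*} [AddCommGroup M] [Module A M]

/-- For `M = L / I`, the exponents of monomials in `L` but not in `I` form a nonempty interval.
Multiplication by a monomial translates it to a standard one, and membership in a submodule of `K`
is decided by exponents. -/
theorem IsBasic.exists_equiv_Q (h : IsBasic M) :
    ∃ X, IsStandardInterval X ∧ Nonempty (M ≃ₗ[A] Q X) := by
  obtain ⟨L, I, hIL, ⟨e⟩⟩ := h.exists_equiv_quotient
  have hup : ∀ (N : Submodule A K) {s r : ℝ}, s ≤ r → HahnSeries.single s 1 ∈ N →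
      HahnSeries.single r 1 ∈ N := by
    intro N s r hsr hs
    refine mem_of_order_le hs (single_ne_zero s) ?_
    rwa [order_single, order_single]
  let X : Set ℝ := {s | HahnSeries.single s 1 ∈ L ∧ HahnSeries.single s 1 ∉ I}
  have hX : X.OrdConnected :=
    ⟨fun s hs r hr x hx => ⟨hup L hx.1 hs.1, fun h => hr.2 (hup I hx.2 h)⟩⟩
  have hne : X.Nonempty := by
    obtain ⟨a, ha, ha'⟩ := SetLike.exists_of_lt hIL
    have h0 : a ≠ 0 := fun h0 => ha' (h0 ▸ I.zero_mem)
    exact ⟨a.order, (mem_iff_single_order_mem h0).1 ha, mt (mem_iff_single_order_mem h0).2 ha'⟩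
  obtain ⟨d, hd⟩ := exists_isStandardInterval_preimage hX hne
  obtain ⟨z, hz⟩ := hne
  have hmul : ∀ (N : Submodule A K) (s : ℝ),
      HahnSeries.single d 1 * HahnSeries.single s 1 ∈ N ↔ HahnSeries.single (s + d) 1 ∈ N := by
    intro N s
    rw [HahnSeries.single_mul_single, one_mul, add_comm]
  have hsupp : ∀ (N : Submodule A K) (H : UpperSet ℝ),
      (∀ s, s ∈ H ↔ HahnSeries.single (s + d) 1 ∈ N) →
      ∀ a, a ∈ supportedIn H ↔ HahnSeries.single d 1 * a ∈ N := by
    intro N H hH a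
    have h1 := mem_iff_forall_support (N := N.comap (LinearMap.mulLeft A (HahnSeries.single d 1)))
      (a := a)
    refine Iff.trans ?_ h1.symm
    exact forall₂_congr fun s _ => (hH s).trans (hmul N s).symm
  obtain ⟨e'⟩ := nonempty_quotient_equiv (single_ne_zero d)
    (hsupp L (leftHull ((fun x => x + d) ⁻¹' X)) (by
      intro s
      constructor
      · rintro ⟨x, hx, hxs⟩
        exact hup L (add_le_add_left hxs d) hx.1
      · intro hs
        by_cases hsI : HahnSeries.single (s + d) 1 ∈ I
        · refine ⟨z - d, ?_, ?_⟩
          · rwa [Set.mem_preimage, sub_add_cancel]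
          · by_contra! hlt
            exact hz.2 (hup I (by linarith) hsI)
        · exact ⟨s, ⟨hs, hsI⟩, le_rfl⟩))
    (hsupp I (rightPart ((fun x => x + d) ⁻¹' X)) (by
      intro s
      constructor
      · intro hs
        by_contra hsI
        have hzs : z - d < s := hs (z - d) (by rwa [Set.mem_preimage, sub_add_cancel])
        exact lt_irrefl s (hs s ⟨hup L (by linarith) hz.1, hsI⟩)
      · intro hs x hx
        by_contra! hle
        exact hx.2 (hup I (add_le_add_left hle d) hs)))
  exact ⟨_, hd, ⟨e.trans e'⟩⟩

theorem isBasic_Q {X : Set ℝ} (hX : IsStandardInterval X) : IsBasic (Q X) := by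
  obtain ⟨s, hs⟩ := isStandardInterval_nonempty hX
  have hs' := (mem_leftHull_and_notMem_rightPart (isStandardInterval_ordConnected hX)).1 hs
  have : Nontrivial (Q X) := by
    rw [Submodule.Quotient.nontrivial_iff]
    intro h
    have h1 : (⟨HahnSeries.single s 1, single_mem_supportedIn.2 hs'.1⟩ :
        supportedIn (leftHull X)) ∈ (supportedIn (rightPart X)).submoduleOf _ := by
      rw [h]
      trivial
    exact hs'.2 (single_mem_supportedIn.1 h1)
  exact isBasic_of_surjective (Submodule.mkQ _) (Submodule.mkQ_surjective _)

/-- An isomorphism between nonzero subquotients of `K` is a multiplication map, and it identifies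
the numerators and the denominators. -/
theorem exists_mul_mem_iff {L I L' I' : Submodule A K} (hI : I < L) (hI' : I' < L')
    (φ : (L ⧸ I.submoduleOf L) ≃ₗ[A] L' ⧸ I'.submoduleOf L') :
    ∃ x : K, x ≠ 0 ∧ (∀ a, a ∈ L ↔ a * x ∈ L') ∧ ∀ a, a ∈ I ↔ a * x ∈ I' := by
  let j : (L' ⧸ I'.submoduleOf L') →ₗ[A] K ⧸ I' := (I'.submoduleOf L').mapQ I' L'.subtype le_rfl
  obtain ⟨x, hx⟩ := exists_eq_mk_mul (j ∘ₗ φ.toLinearMap ∘ₗ (I.submoduleOf L).mkQ)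
  have hrel : ∀ (a : L) (l : L'), φ (Submodule.Quotient.mk a) = Submodule.Quotient.mk l →
      (l : K) - a * x ∈ I' := by
    intro a l hal
    have h1 := hx a
    simp only [LinearMap.comp_apply, LinearEquiv.coe_coe, Submodule.mkQ_apply] at h1
    rw [hal] at h1
    exact (Submodule.Quotient.eq I').1 h1
  have hL1 : ∀ a ∈ L, a * x ∈ L' := by
    intro a ha
    obtain ⟨l, hl⟩ := Submodule.Quotient.mk_surjective _ (φ (Submodule.Quotient.mk ⟨a, ha⟩))
    have := hI'.le (hrel ⟨a, ha⟩ l hl.symm)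
    exact (Submodule.sub_mem_iff_right _ l.2).1 this
  have hI1 : ∀ a (ha : a ∈ L), a ∈ I ↔ a * x ∈ I' := by
    intro a ha
    obtain ⟨l, hl⟩ := Submodule.Quotient.mk_surjective _ (φ (Submodule.Quotient.mk ⟨a, ha⟩))
    have h1 := hrel ⟨a, ha⟩ l hl.symm
    have h2 : (l : K) ∈ I' ↔ a * x ∈ I' := by
      rw [← Submodule.sub_mem_iff_left (p := I') (x := a * x) (y := a * x - l) ?_, sub_sub_cancel]
      rw [← I'.neg_mem_iff, neg_sub]
      exact h1
    rw [← h2]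
    have h3 : (⟨a, ha⟩ : L) ∈ I.submoduleOf L ↔ l ∈ I'.submoduleOf L' := by
      rw [← Submodule.Quotient.mk_eq_zero, ← Submodule.Quotient.mk_eq_zero, hl,
        LinearEquiv.map_eq_zero_iff]
    exact h3
  have hsurj : ∀ l ∈ L', ∃ a ∈ L, l - a * x ∈ I' := by
    intro l hl
    obtain ⟨a, ha⟩ := Submodule.Quotient.mk_surjective _
      (φ.symm (Submodule.Quotient.mk ⟨l, hl⟩))
    exact ⟨a, a.2, hrel a ⟨l, hl⟩ (by rw [ha, φ.apply_symm_apply])⟩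
  let xL := L.map (LinearMap.mulRight A x)
  -- Surjectivity gives `L' = xL + I'`. If `xL ≤ I'`, this would make `L' ≤ I'`; hence `I' ≤ xL`,
  -- and so `L' = xL`.
  have hle : I' ≤ xL := by
    refine (submodule_le_total I' xL).elim id fun h => absurd (fun l hl => ?_) hI'.not_ge
    obtain ⟨a, ha, hal⟩ := hsurj l hl
    have hax : a * x ∈ I' := h ⟨a, ha, rfl⟩
    exact (Submodule.sub_mem_iff_left _ hax).1 hal
  have hx0 : x ≠ 0 := by
    rintro rfl
    refine hI'.not_ge fun l hl => ?_
    obtain ⟨a, -, hal⟩ := hsurj l hl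
    rwa [mul_zero, sub_zero] at hal
  have hxL : ∀ a, a * x ∈ xL → a ∈ L := by
    rintro a ⟨b, hb, hab⟩
    rwa [← mul_right_cancel₀ hx0 hab]
  have hL2 : ∀ a, a ∈ L ↔ a * x ∈ L' := by
    refine fun a => ⟨hL1 a, fun h => hxL a ?_⟩
    obtain ⟨b, hb, hab⟩ := hsurj _ h
    have hbx : b * x ∈ xL := ⟨b, hb, rfl⟩
    exact (Submodule.sub_mem_iff_left _ hbx).1 (hle hab)
  refine ⟨x, hx0, hL2, fun a => ⟨fun h => (hI1 a (hI.le h)).1 h, fun h => ?_⟩⟩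
  exact (hI1 a (hxL a (hle h))).2 h

/-- The isomorphism is multiplication by some `x`, which shifts exponents by `x.order`; so the
intervals are translates of each other. -/
theorem eq_of_equiv_Q {X X' : Set ℝ} (hX : IsStandardInterval X) (hX' : IsStandardInterval X')
    (φ : Q X ≃ₗ[A] Q X') : X = X' := by
  have hlt : ∀ {X : Set ℝ}, IsStandardInterval X →
      supportedIn (rightPart X) < supportedIn (leftHull X) := by
    intro X hX
    obtain ⟨s, hs⟩ := isStandardInterval_nonempty hX
    have hs' := (mem_leftHull_and_notMem_rightPart (isStandardInterval_ordConnected hX)).1 hs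
    refine SetLike.lt_iff_le_and_exists.2 ⟨fun a ha q hq => ?_, _,
      single_mem_supportedIn.2 hs'.1, mt single_mem_supportedIn.1 hs'.2⟩
    exact ⟨s, hs, (ha hq s hs).le⟩
  obtain ⟨x, hx0, hL, hR⟩ := exists_mul_mem_iff (hlt hX) (hlt hX') φ
  have hmul : ∀ (H H' : UpperSet ℝ), (∀ a, a ∈ supportedIn H ↔ a * x ∈ supportedIn H') →
      ∀ s, s ∈ H ↔ s + x.order ∈ H' := by
    intro H H' h s
    rw [← single_mem_supportedIn, h,
      mem_iff_single_order_mem (mul_ne_zero (single_ne_zero s) hx0),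
      HahnSeries.order_mul (single_ne_zero s) hx0, order_single, single_mem_supportedIn]
  refine isStandardInterval_eq_of_translate hX hX' (d := x.order) fun s => ?_
  rw [mem_leftHull_and_notMem_rightPart (isStandardInterval_ordConnected hX),
    mem_leftHull_and_notMem_rightPart (isStandardInterval_ordConnected hX'),
    hmul _ _ hL, hmul _ _ hR]

end

/-! ### Local endomorphism rings of basic modules -/

section LocalEndomorphisms

variable {B : Type*} [AddCommGroup B] [Module A B]

theorem IsBasic.of_equiv {C : Type*} [AddCommGroup C] [Module A C] (h : IsBasic B)
    (e : B ≃ₗ[A] C) : IsBasic C := by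
  obtain ⟨hB, h⟩ := h
  refine ⟨e.symm.toEquiv.nontrivial, fun x y => ?_⟩
  refine (h (e.symm x) (e.symm y)).imp ?_ ?_
  all_goals
    rintro ⟨a, ha⟩
    exact ⟨a, e.symm.injective (by rw [ha, map_smul])⟩

theorem isUnit_or_isUnit_one_sub (b : A) : IsUnit b ∨ IsUnit (1 - b) := by
  by_contra! h
  have h1 : (b : K) ∈ IPos := by_contra fun h' => h.1 (isUnit_of_notMem_IPos h')
  have h2 : ((1 - b : A) : K) ∈ IPos := by_contra fun h' => h.2 (isUnit_of_notMem_IPos h')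
  have h3 := IPos.add_mem h1 h2
  rw [← A.coe_add, add_sub_cancel] at h3
  exact one_notMem_IPos h3

/-- Submodules of a basic module form a chain, and the two kernels meet in 0. -/
theorem IsBasic.injective_or_injective (h : IsBasic B) {f g : B →ₗ[A] B}
    (hfg : ∀ x, f x + g x = x) : Function.Injective f ∨ Function.Injective g := by
  rw [injective_iff_map_eq_zero, injective_iff_map_eq_zero]
  by_contra! hcon
  obtain ⟨⟨x, hx, hx0⟩, ⟨y, hy, hy0⟩⟩ := hcon
  rcases h.2 x y with ⟨a, rfl⟩ | ⟨a, rfl⟩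
  · exact hx0 (by rw [← hfg (a • y), hx, map_smul, hy, smul_zero, add_zero])
  · exact hy0 (by rw [← hfg (a • x), hy, map_smul, hx, smul_zero, add_zero])

/-- Otherwise some `w` lies in neither image. One of `f w` and `g w` is a multiple of the other, so
`w = f w + g w` lies in one of the images. -/
theorem IsBasic.surjective_or_surjective (h : IsBasic B) {f g : B →ₗ[A] B}
    (hfg : ∀ x, f x + g x = x) : Function.Surjective f ∨ Function.Surjective g := by
  by_contra hcon
  simp only [not_or, Function.Surjective, not_forall] at hcon
  obtain ⟨⟨y, hy⟩, ⟨z, hz⟩⟩ := hcon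
  have hmem : ∀ (p : B →ₗ[A] B) (a : A) (x : B), (∃ w, p w = x) → ∃ w, p w = a • x := by
    rintro p a _ ⟨w, rfl⟩
    exact ⟨a • w, map_smul p a w⟩
  obtain ⟨w, hwf, hwg⟩ : ∃ w, (¬ ∃ x, f x = w) ∧ ¬ ∃ x, g x = w := by
    rcases h.2 y z with ⟨a, rfl⟩ | ⟨a, rfl⟩
    · exact ⟨z, mt (hmem f a z) hy, hz⟩
    · exact ⟨y, hy, mt (hmem g a y) hz⟩
  rcases h.2 (f w) (g w) with ⟨a, ha⟩ | ⟨a, ha⟩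
  · exact hwg ⟨a • w + w, by rw [map_add, map_smul, ← ha, hfg]⟩
  · exact hwf ⟨w + a • w, by rw [map_add, map_smul, ← ha, hfg]⟩

/-- If `g x = 0`, then `f x = x`. For `y` outside the image of `f`, this forces `x = a • y` and `f y
= b • y` with `b` not a unit. Then `(1 - b) • x = 0` with `1 - b` a unit, so `x = 0`. -/
theorem IsBasic.injective_of_not_surjective (h : IsBasic B) {f g : B →ₗ[A] B}
    (hfg : ∀ x, f x + g x = x) (hf' : ¬ Function.Surjective f) :
    Function.Injective g := by
  rw [injective_iff_map_eq_zero]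
  intro x hx
  have hfx : f x = x := by rw [← add_zero (f x), ← hx, hfg]
  simp only [Function.Surjective, not_forall, not_exists] at hf'
  obtain ⟨y, hy⟩ := hf'
  rcases h.2 y x with ⟨a, rfl⟩ | ⟨a, rfl⟩
  · exact absurd (by rw [map_smul, hfx]) (hy (a • x))
  rcases h.2 y (f y) with ⟨b, hb⟩ | ⟨b, hb⟩
  · exact absurd (by rw [map_smul, ← hb]) (hy (b • y))
  rcases isUnit_or_isUnit_one_sub b with ⟨u, rfl⟩ | hu
  · refine absurd ?_ (hy ((↑u⁻¹ : A) • y))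
    rw [map_smul, hb, smul_smul, Units.inv_mul, one_smul]
  · refine hu.smul_eq_zero.1 ?_
    rw [map_smul, hb, smul_comm] at hfx
    rw [sub_smul, one_smul, hfx, sub_self]

/-- The endomorphism ring of a basic module is local. -/
theorem IsBasic.bijective_or_bijective (h : IsBasic B) {f g : B →ₗ[A] B}
    (hfg : ∀ x, f x + g x = x) : Function.Bijective f ∨ Function.Bijective g := by
  have hgf : ∀ x, g x + f x = x := fun x => by rw [add_comm, hfg]
  have hs := h.surjective_or_surjective hfg
  rcases h.injective_or_injective hfg with hf | hg
  · by_cases hf' : Function.Surjective f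
    · exact .inl ⟨hf, hf'⟩
    · exact .inr ⟨h.injective_of_not_surjective hfg hf', hs.resolve_left hf'⟩
  · by_cases hg' : Function.Surjective g
    · exact .inr ⟨hg, hg'⟩
    · exact .inl ⟨h.injective_of_not_surjective hgf hg', hs.resolve_right hg'⟩

theorem IsBasic.exists_bijective_of_sum (h : IsBasic B) {ι : Type*} (s : Finset ι)
    (f : ι → B →ₗ[A] B) (hf : Function.Bijective ⇑(∑ i ∈ s, f i)) :
    ∃ i ∈ s, Function.Bijective (f i) := by
  classical
  induction s using Finset.induction_on with
  | empty =>
    have := h.1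
    obtain ⟨x, hx⟩ := exists_ne (0 : B)
    exact absurd (hf.1 (by simp : (∑ i ∈ ∅, f i) x = (∑ i ∈ ∅, f i) 0)) hx
  | insert i s hi ih =>
    let e := LinearEquiv.ofBijective _ hf
    have key : ∀ g : B →ₗ[A] B, Function.Bijective (e.symm.toLinearMap ∘ₗ g) →
        Function.Bijective g := by
      intro g hg
      exact (e.symm.bijective.of_comp_iff' g).1 hg
    rcases h.bijective_or_bijective (f := e.symm.toLinearMap ∘ₗ f i)
      (g := e.symm.toLinearMap ∘ₗ ∑ i ∈ s, f i) (fun x => by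
        simp only [LinearMap.comp_apply, LinearEquiv.coe_coe]
        rw [← map_add, e.symm_apply_eq, ← LinearMap.add_apply, ← Finset.sum_insert hi]
        rfl) with h1 | h1
    · exact ⟨i, Finset.mem_insert_self i s, key _ h1⟩
    · obtain ⟨j, hj, hj'⟩ := ih (key _ h1)
      exact ⟨j, Finset.mem_insert_of_mem hj, hj'⟩

/-- The kernel of `g` and the image of `f` are comparable and meet in 0. The image is nonzero, so
`g` is injective, and then `f` is onto. -/
theorem IsBasic.bijective_of_bijective_comp {C : Type*} [AddCommGroup C] [Module A C]
    (hB : IsBasic B) (hC : IsBasic C) (f : B →ₗ[A] C) (g : C →ₗ[A] B)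
    (h : Function.Bijective (g ∘ₗ f)) : Function.Bijective f := by
  have hf : Function.Injective f := (show Function.Injective (g ∘ f) from h.1).of_comp
  refine ⟨hf, ?_⟩
  have hg : Function.Injective g := by
    rw [injective_iff_map_eq_zero]
    intro y hy
    have := hB.1
    obtain ⟨x, hx⟩ := exists_ne (0 : B)
    rcases hC.2 y (f x) with ⟨a, rfl⟩ | ⟨a, ha⟩
    · have h1 : (g ∘ₗ f) (a • x) = 0 := by rw [LinearMap.comp_apply, map_smul, hy]
      rw [← map_smul, (injective_iff_map_eq_zero _).1 h.1 _ h1, map_zero]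
    · refine absurd ((injective_iff_map_eq_zero _).1 h.1 x ?_) hx
      rw [LinearMap.comp_apply, ha, map_smul, hy, smul_zero]
  intro y
  obtain ⟨x, hx⟩ := h.2 (g y)
  exact ⟨x, hg hx⟩

end LocalEndomorphisms

/-! ### Cancellation and the Krull–Schmidt theorem -/

/-- The isomorphism is a Schur complement: `b` identifies `X₂` with the vectors whose image under
`φ` has first coordinate 0. -/
theorem nonempty_equiv_of_prod_equiv {R X₁ X₂ Y₁ Y₂ : Type*} [Ring R] [AddCommGroup X₁]
    [AddCommGroup X₂] [AddCommGroup Y₁] [AddCommGroup Y₂] [Module R X₁] [Module R X₂] [Module R Y₁]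
    [Module R Y₂] (φ : (X₁ × X₂) ≃ₗ[R] Y₁ × Y₂)
    (h : Function.Bijective (LinearMap.fst R Y₁ Y₂ ∘ₗ φ.toLinearMap ∘ₗ LinearMap.inl R X₁ X₂)) :
    Nonempty (X₂ ≃ₗ[R] Y₂) := by
  let a := LinearEquiv.ofBijective _ h
  have ha : ∀ x, a x = (φ (x, 0)).1 := fun _ => rfl
  let b : X₂ →ₗ[R] X₁ × X₂ := LinearMap.inr R X₁ X₂ -
    LinearMap.inl R X₁ X₂ ∘ₗ a.symm.toLinearMap ∘ₗ LinearMap.fst R Y₁ Y₂ ∘ₗ φ.toLinearMap ∘ₗ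
      LinearMap.inr R X₁ X₂
  have hb : ∀ x, b x = (-a.symm (φ (0, x)).1, x) := fun x => by simp [b]
  have hdecomp : ∀ x₁ x₂, (φ (x₁, x₂)).1 = a x₁ + (φ (0, x₂)).1 := by
    intro x₁ x₂
    rw [ha, ← Prod.fst_add, ← map_add, Prod.mk_add_mk, add_zero, zero_add]
  have hfst : ∀ x, (φ (b x)).1 = 0 := fun x => by
    rw [hb, hdecomp, map_neg, a.apply_symm_apply, neg_add_cancel]
  refine ⟨LinearEquiv.ofBijective (LinearMap.snd R Y₁ Y₂ ∘ₗ φ.toLinearMap ∘ₗ b) ⟨?_, ?_⟩⟩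
  · rw [injective_iff_map_eq_zero]
    intro x hx
    have h1 : φ (b x) = 0 := Prod.ext (hfst x) hx
    rw [LinearEquiv.map_eq_zero_iff, hb] at h1
    exact congrArg Prod.snd h1
  · intro y
    obtain ⟨⟨x₁, x₂⟩, hx⟩ := φ.surjective (0, y)
    refine ⟨x₂, ?_⟩
    have h1 : a x₁ + (φ (0, x₂)).1 = 0 := by rw [← hdecomp, hx]
    have h2 : b x₂ = (x₁, x₂) := by
      rw [hb, eq_neg_of_add_eq_zero_right h1, map_neg, a.symm_apply_apply, neg_neg]
    simp [h2, hx]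

universe u v

/-- The Krull–Schmidt theorem for finite products of basic modules. -/
theorem exists_equiv_of_pi_equiv {m : ℕ} : ∀ {n : ℕ} {B : Fin m → Type u} {C : Fin n → Type v}
    [∀ i, AddCommGroup (B i)] [∀ i, AddCommGroup (C i)] [∀ i, Module A (B i)]
    [∀ i, Module A (C i)] (_ : ∀ i, IsBasic (B i)) (_ : ∀ i, IsBasic (C i))
    (_ : (∀ i, B i) ≃ₗ[A] ∀ i, C i), ∃ σ : Fin m ≃ Fin n, ∀ i, Nonempty (B i ≃ₗ[A] C (σ i)) := by
  induction m with
  | zero =>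
    intro n B C _ _ _ _ hB hC φ
    rcases n with _ | n
    · exact ⟨Equiv.refl _, fun i => i.elim0⟩
    · have := (hC 0).1
      obtain ⟨x, hx⟩ := exists_ne (0 : C 0)
      refine absurd ?_ hx
      have h1 := φ.symm.injective (Subsingleton.elim (φ.symm (Pi.single 0 x)) (φ.symm 0))
      simpa using congrFun h1 0
  | succ m ih =>
    intro n B C _ _ _ _ hB hC φ
    let f : ∀ j, B 0 →ₗ[A] C j := fun j =>
      LinearMap.proj j ∘ₗ φ.toLinearMap ∘ₗ LinearMap.single A B 0
    let g : ∀ j, C j →ₗ[A] B 0 := fun j =>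
      LinearMap.proj 0 ∘ₗ φ.symm.toLinearMap ∘ₗ LinearMap.single A C j
    -- The identity of `B 0` is a sum of endomorphisms factoring through the `C j`; by locality one
    -- term is bijective, so `B 0` is isomorphic to that `C j`.
    have hsum : ∑ j, g j ∘ₗ f j = LinearMap.id := by
      ext x
      have h1 : ∑ j, Pi.single j (φ (Pi.single 0 x) j) = φ (Pi.single 0 x) :=
        Finset.univ_sum_single _
      have h2 := congrArg (fun v => φ.symm v 0) h1
      simp only [φ.symm_apply_apply, Pi.single_eq_same, map_sum, Finset.sum_apply] at h2
      rw [LinearMap.sum_apply]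
      exact h2
    obtain ⟨j, -, hj⟩ := (hB 0).exists_bijective_of_sum Finset.univ (fun j => g j ∘ₗ f j) (by
      rw [hsum]
      exact Function.bijective_id)
    have hfj := (hB 0).bijective_of_bijective_comp (hC j) _ _ hj
    rcases n with _ | n
    · exact j.elim0
    -- The swap moves `C j` to the front, so that it can be cancelled against `B 0`.
    let τ : Fin (n + 1) ≃ Fin (n + 1) := Equiv.swap 0 j
    have hτ : τ 0 = j := Equiv.swap_apply_left 0 j
    let e := LinearEquiv.piCongrLeft A C τ
    let φ' : (B 0 × ∀ i, B (Fin.succ i)) ≃ₗ[A] C (τ 0) × ∀ i, C (τ (Fin.succ i)) :=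
      (Fin.consLinearEquiv A B).trans ((φ.trans e.symm).trans
        (Fin.consLinearEquiv A fun i => C (τ i)).symm)
    obtain ⟨ψ⟩ := nonempty_equiv_of_prod_equiv φ' (by
      have h1 : (LinearMap.fst A _ _ ∘ₗ φ'.toLinearMap ∘ₗ LinearMap.inl A _ _) = f (τ 0) := by
        ext x
        have h2 : Fin.consLinearEquiv A B (x, 0) = Pi.single 0 x := by
          ext i
          induction i using Fin.cases with
          | zero => simp
          | succ i => simp
        change φ (Fin.consLinearEquiv A B (x, 0)) (τ 0) = φ (Pi.single 0 x) (τ 0)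
        rw [h2]
      rw [h1, hτ]
      exact hfj)
    obtain ⟨σ, hσ⟩ := ih (fun i => hB i.succ) (fun i => hC (τ i.succ)) ψ
    let ρ : Fin (m + 1) ≃ Fin (n + 1) :=
      (((finSuccEquiv m).trans (Equiv.optionCongr σ)).trans (finSuccEquiv n).symm).trans τ
    refine ⟨ρ, fun i => ?_⟩
    induction i using Fin.cases with
    | zero =>
      have : ρ 0 = j := by simp [ρ, hτ]
      rw [this]
      exact ⟨LinearEquiv.ofBijective _ hfj⟩
    | succ i =>
      have : ρ i.succ = τ (σ i).succ := by simp [ρ]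
      rw [this]
      exact hσ i

section

variable {M : Type*} [AddCommGroup M] [Module A M]

theorem exists_equiv_of_isBasicDecomposition {m n : ℕ} {N : Fin m → Submodule A M}
    {N' : Fin n → Submodule A M} (h : IsBasicDecomposition N) (h' : IsBasicDecomposition N') :
    ∃ σ : Fin m ≃ Fin n, ∀ i, Nonempty (N i ≃ₗ[A] N' (σ i)) := by
  let e := (LinearEquiv.ofBijective (DirectSum.coeLinearMap N) h.2).symm.trans
    (DirectSum.linearEquivFunOnFintype A (Fin m) fun i => N i)
  let e' := (LinearEquiv.ofBijective (DirectSum.coeLinearMap N') h'.2).symm.trans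
    (DirectSum.linearEquivFunOnFintype A (Fin n) fun i => N' i)
  exact exists_equiv_of_pi_equiv h.1 h'.1 (e.symm.trans e')

theorem IsStandardDecomposition.isBasicDecomposition {n : ℕ} {N : Fin n → Submodule A M}
    {X : Fin n → Set ℝ} (h : IsStandardDecomposition N X) : IsBasicDecomposition N :=
  ⟨fun i => (isBasic_Q (h.2 i).1).of_equiv (h.2 i).2.some.symm, h.1⟩

end

end HahnTheory

end

theorem mainTheorem1 (M : Type*) [AddCommGroup M] [Module HahnTheory.A M] :
      (HahnTheory.IsThetaReflexive M ↔ HahnTheory.IsMultibasic M) ∧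
      (HahnTheory.IsMultibasic M →
        -- a decomposition into standard basic modules exists
        (∃ (n : ℕ) (N : Fin n → Submodule HahnTheory.A M) (X : Fin n → Set ℝ),
          HahnTheory.IsStandardDecomposition N X) ∧
        -- any two such decompositions have the same standard basic summands, up to order
        (∀ (m n : ℕ) (N : Fin m → Submodule HahnTheory.A M) (X : Fin m → Set ℝ)
          (N' : Fin n → Submodule HahnTheory.A M) (X' : Fin n → Set ℝ),
          HahnTheory.IsStandardDecomposition N X → HahnTheory.IsStandardDecomposition N' X' →
            ∃ σ : Fin m ≃ Fin n, ∀ i, X i = X' (σ i)) ∧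
        -- any two decompositions into basic submodules agree up to order and isomorphism
        (∀ (m n : ℕ) (N : Fin m → Submodule HahnTheory.A M)
          (N' : Fin n → Submodule HahnTheory.A M),
          HahnTheory.IsBasicDecomposition N → HahnTheory.IsBasicDecomposition N' →
            ∃ σ : Fin m ≃ Fin n, ∀ i, Nonempty (N i ≃ₗ[HahnTheory.A] N' (σ i)))) := by
  open HahnTheory in
  refine ⟨isThetaReflexive_iff_isMultibasic, fun hM => ⟨?_, ?_, ?_⟩⟩
  · obtain ⟨n, N, hN, hint⟩ := hM
    choose X hX e using fun i => (hN i).exists_equiv_Q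
    exact ⟨n, N, X, hint, fun i => ⟨hX i, e i⟩⟩
  · intro m n N X N' X' h h'
    obtain ⟨σ, hσ⟩ := exists_equiv_of_isBasicDecomposition h.isBasicDecomposition
      h'.isBasicDecomposition
    refine ⟨σ, fun i => eq_of_equiv_Q (h.2 i).1 (h'.2 (σ i)).1 ?_⟩
    exact ((h.2 i).2.some.symm.trans (hσ i).some).trans (h'.2 (σ i)).2.some
  · exact fun m n N N' h h' => exists_equiv_of_isBasicDecomposition h h'
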